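/- Let $\Sigma$ be a closed connected oriented surface with a smooth area form $\rho$, and put $c := 2\pi(2-2\,\mathrm{genus}(\Sigma))/\mathrm{vol}(\Sigma,\rho)$. Let $\mathcal Q(\Sigma)$ be the set of pairs $(J,\sigma)$, where $J$ is a smooth almost complex structure on $\Sigma$ compatible with the orientation and $\sigma$ is a smooth quadratic differential for $J$, that is, a smooth section of the bundle of symmetric $(J,\mathbf i)$-complex bilinear forms on $T\Sigma$. For $J$ as above let $g_J=\rho(\cdot,J\cdot)$, let $\nabla$ be its Levi-Civita connection, $K_J$ its Gaussian curvature and $\Delta=d^*d$ its positive Laplacian, and put $(\partial_J\sigma)(u)=\frac12(\nabla_u\sigma-\mathbf i\nabla_{Ju}\sigma)$, $(\bar\partial_J\sigma)(u)=\frac12(\nabla_u\sigma+\mathbf i\nabla_{Ju}\sigma)$. Norms are taken with respect to $g_J$: $|\sigma|=|\sigma(v,v)|$ and $|\tau|=|\tau(u)|$ for $g_J$-unit vectors $u,v$ and $\tau\in\{\partial_J\sigma,\bar\partial_J\sigma\}$. For $(J,\sigma)\in\mathcal Q(\Sigma)$ with $|\sigma|<1$ everywhere define the $2$-form $$\underline\mu_1(J,\sigma)=\frac{|\partial_J\sigma|^2-|\bar\partial_J\sigma|^2}{\sqrt{1-|\sigma|^2}}\,\rho-2\sqrt{1-|\sigma|^2}\,K_J\,\rho-2\mathbf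 i\,\bar\partial_J\partial_J\sqrt{1-|\sigma|^2}+2c\rho .$$ If $(J,\sigma)\in\mathcal Q(\Sigma)$ satisfies $|\sigma|<1$ and $\bar\partial_J\sigma=0$, then $$\underline\mu_1(J,\sigma)=-\left(2K_J+\Delta\log\left(1+\sqrt{1-|\sigma|^2}\right)\right)\rho+2c\rho .$$ In particular, let $\mathrm{Symp}_0(\Sigma,\rho)$ be the group of diffeomorphisms of $\Sigma$ that are joined to the identity by a smooth path of diffeomorphisms preserving $\rho$, acting on $\mathcal Q(\Sigma)$ by pullback. Then the moduli space $$\mathcal M_s:=\left\{(J,\sigma)\in\mathcal Q(\Sigma)\;\middle|\;\underline\mu_1(J,\sigma)=0,\ \bar\partial_J\sigma=0,\ |\sigma|<1\right\}\Big/\mathrm{Symp}_0(\Sigma,\rho)$$ satisfies $$\mathcal M_s=\left\{(J,\sigma)\in\mathcal Q(\Sigma)\;\middle|\;\bar\partial_J\sigma=0,\ |\sigma|<1,\ K_J+\tfrac12\Delta\log\left(1+\sqrt{1-|\sigma|^2}\right)=c\right\}\Big/\mathrm{Symp}_0(\Sigma,\rho).$$ -/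

import Mathlib

open scoped Manifold ContDiff

noncomputable section

namespace AlmostFuchsian

/-- The model plane `ℝ²`. -/
abbrev Plane : Type := EuclideanSpace ℝ (Fin 2)

/-- The tangent space `T_x S` of a surface `S`. -/
abbrev Tan {S : Type*} [TopologicalSpace S] [ChartedSpace Plane S] (x : S) : Type :=
  TangentSpace (𝓡 2) x

section Coordinates

variable {S : Type*} [TopologicalSpace S] [ChartedSpace Plane S]

/-- The inverse `ℝ² ⊇ target → S` of the chart around `x₀`. -/
def chartInv (x₀ : S) : Plane → S := (extChartAt (𝓡 2) x₀).symm

/-- The coordinate vector `∂_i`, of the chart around `x₀`, at the point with coordinates `y`. -/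
def coordVec (x₀ : S) (y : Plane) (i : Fin 2) : Tan (chartInv x₀ y) :=
  mfderiv (𝓡 2) (𝓡 2) (chartInv x₀) y (EuclideanSpace.single i (1 : ℝ) : Plane)

/-- The `i`-th component of a tangent vector `v ∈ T_x S` in the chart around `x₀`. -/
def comp (x₀ x : S) (v : Tan x) (i : Fin 2) : ℝ :=
  let w : Plane := mfderiv (𝓡 2) (𝓡 2) (extChartAt (𝓡 2) x₀) x v
  w i

/-- The derivative `df(u)` of a real function `f` on `S`. -/
def diff (f : S → ℝ) (x : S) (u : Tan x) : ℝ := mfderiv (𝓡 2) 𝓘(ℝ, ℝ) f x u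

/-- The partial derivative `∂_i f` of a function on the plane. -/
def pd {F : Type*} [NormedAddCommGroup F] [NormedSpace ℝ F] (i : Fin 2) (f : Plane → F)
    (y : Plane) : F :=
  fderiv ℝ f y (EuclideanSpace.single i (1 : ℝ))

end Coordinates

/-- A smooth area form on `S`: a smooth nowhere vanishing `2`-form. It orients `S`. -/
structure AreaForm (S : Type*) [TopologicalSpace S] [ChartedSpace Plane S] where
  form : ∀ x : S, Tan x →L[ℝ] Tan x →L[ℝ] ℝ
  alt : ∀ (x : S) (v : Tan x), form x v v = 0
  ne_zero : ∀ x : S, form x ≠ 0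
  smooth : ∀ (x₀ : S) (i j : Fin 2),
    ContDiffOn ℝ ∞ (fun y => form (chartInv x₀ y) (coordVec x₀ y i) (coordVec x₀ y j))
      (extChartAt (𝓡 2) x₀).target

section Geometry

variable {S : Type*} [TopologicalSpace S] [ChartedSpace Plane S]

/-- The space `𝒥(S)`: smooth almost complex structures on `S` that are compatible with the
orientation given by the area form `ρ`. -/
structure ComplexStructure (ρ : AreaForm S) where
  J : ∀ x : S, Tan x →L[ℝ] Tan x
  sq : ∀ (x : S) (v : Tan x), J x (J x v) = -v
  pos : ∀ (x : S) (v : Tan x), v ≠ 0 → 0 < ρ.form x v (J x v)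
  smooth : ∀ (x₀ : S) (i k : Fin 2),
    ContDiffOn ℝ ∞ (fun y => comp x₀ (chartInv x₀ y) (J (chartInv x₀ y) (coordVec x₀ y i)) k)
      (extChartAt (𝓡 2) x₀).target

variable {ρ : AreaForm S}

/-- The Riemannian metric `g = ρ(·, J·)`. -/
def ComplexStructure.metric (J : ComplexStructure ρ) (x : S) (u v : Tan x) : ℝ :=
  ρ.form x u (J.J x v)

/-- The matrix `(g_ij)` of the metric in the chart around `x₀`. -/
def ComplexStructure.gram (J : ComplexStructure ρ) (x₀ : S) (y : Plane) :
    Matrix (Fin 2) (Fin 2) ℝ :=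
  Matrix.of fun i j => J.metric (chartInv x₀ y) (coordVec x₀ y i) (coordVec x₀ y j)

/-- The Christoffel symbols `Γ^k_{ij}` of the Levi-Civita connection of `g` in the chart
around `x₀`. -/
def ComplexStructure.christoffel (J : ComplexStructure ρ) (x₀ : S) (k i j : Fin 2)
    (y : Plane) : ℝ :=
  (1 / 2) * ∑ l, (J.gram x₀ y)⁻¹ k l *
    (pd i (fun z => J.gram x₀ z j l) y + pd j (fun z => J.gram x₀ z i l) y
      - pd l (fun z => J.gram x₀ z i j) y)

/-- The components `R^l` of the curvature tensor,
`R(∂_i, ∂_j) ∂_k = ∇_i ∇_j ∂_k - ∇_j ∇_i ∂_k = ∑ l, R^l ∂_l`. -/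
def ComplexStructure.riemann (J : ComplexStructure ρ) (x₀ : S) (l i j k : Fin 2)
    (y : Plane) : ℝ :=
  pd i (J.christoffel x₀ l j k) y - pd j (J.christoffel x₀ l i k) y
    + ∑ m, (J.christoffel x₀ m j k y * J.christoffel x₀ l i m y
      - J.christoffel x₀ m i k y * J.christoffel x₀ l j m y)

/-- The Gaussian curvature `K_J = g(R(∂₁, ∂₂) ∂₂, ∂₁) / det g` of `g = ρ(·, J·)`. -/
def ComplexStructure.gaussCurvature (J : ComplexStructure ρ) (x : S) : ℝ :=
  (∑ l, J.gram x (extChartAt (𝓡 2) x x) l 0 * J.riemann x l 0 1 1 (extChartAt (𝓡 2) x x))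
    / (J.gram x (extChartAt (𝓡 2) x x)).det

/-- The positive Laplacian `Δ f = d^* d f = - (det g)^{-1/2} ∂_i ((det g)^{1/2} g^{ij} ∂_j f)`
of the metric `g = ρ(·, J·)`. -/
def ComplexStructure.laplacian (J : ComplexStructure ρ) (f : S → ℝ) (x : S) : ℝ :=
  - (1 / Real.sqrt (J.gram x (extChartAt (𝓡 2) x x)).det) *
    ∑ i, pd i (fun z => Real.sqrt (J.gram x z).det *
      ∑ j, (J.gram x z)⁻¹ i j * pd j (fun w => f (chartInv x w)) z) (extChartAt (𝓡 2) x x)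

/-- The `(1,0)`-form `∂_J f = (df - i df ∘ J) / 2` of a real function `f`. -/
def ComplexStructure.del (J : ComplexStructure ρ) (f : S → ℝ) (x : S) (u : Tan x) : ℂ :=
  (1 / 2) * ((diff f x u : ℂ) - Complex.I * (diff f x (J.J x u) : ℂ))

/-- The exterior derivative of a complex-valued `1`-form. -/
def extD (α : ∀ x : S, Tan x → ℂ) (x : S) (u v : Tan x) : ℂ :=
  ∑ i, ∑ j, ((comp x x u i * comp x x v j : ℝ) : ℂ) *
    (pd i (fun y => α (chartInv x y) (coordVec x y j)) (extChartAt (𝓡 2) x x)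
      - pd j (fun y => α (chartInv x y) (coordVec x y i)) (extChartAt (𝓡 2) x x))

/-- The `2`-form `∂̄_J ∂_J f`. On a Riemann surface there are no `(2,0)`-forms, hence the
operator `∂̄_J` on the `(1,0)`-form `∂_J f` is the exterior derivative. -/
def ComplexStructure.dbarDel (J : ComplexStructure ρ) (f : S → ℝ) (x : S) (u v : Tan x) : ℂ :=
  extD (J.del f) x u v

/-- The space `Q(J)` of smooth quadratic differentials: smooth sections of the bundle of
symmetric `(J,i)`-complex bilinear forms on the tangent spaces. -/
structure QuadraticDifferential (J : ComplexStructure ρ) where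
  q : ∀ x : S, Tan x →L[ℝ] Tan x →L[ℝ] ℂ
  symm : ∀ (x : S) (u v : Tan x), q x u v = q x v u
  map_J : ∀ (x : S) (u v : Tan x), q x (J.J x u) v = Complex.I * q x u v
  smooth : ∀ (x₀ : S) (i j : Fin 2),
    ContDiffOn ℝ ∞ (fun y => q (chartInv x₀ y) (coordVec x₀ y i) (coordVec x₀ y j))
      (extChartAt (𝓡 2) x₀).target

variable {J : ComplexStructure ρ}

/-- The pointwise norm `|σ|_J = |σ(v,v)|` for any `g`-unit vector `v`. By complex bilinearity all
unit vectors give the same value, so the supremum is over a single number. -/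
def QuadraticDifferential.norm (σ : QuadraticDifferential J) (x : S) : ℝ :=
  sSup {r : ℝ | ∃ v : Tan x, J.metric x v v = 1 ∧ r = ‖σ.q x v v‖}

/-- The components `(∇_k σ)_{ij}` of the Levi-Civita covariant derivative in the chart
around `x₀`. -/
def QuadraticDifferential.nablaComp (σ : QuadraticDifferential J) (x₀ : S) (k i j : Fin 2)
    (y : Plane) : ℂ :=
  pd k (fun z => σ.q (chartInv x₀ z) (coordVec x₀ z i) (coordVec x₀ z j)) y
    - ∑ l, (J.christoffel x₀ l k i y : ℂ) *
        σ.q (chartInv x₀ y) (coordVec x₀ y l) (coordVec x₀ y j)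
    - ∑ l, (J.christoffel x₀ l k j y : ℂ) *
        σ.q (chartInv x₀ y) (coordVec x₀ y i) (coordVec x₀ y l)

/-- The covariant derivative `(∇_u σ)(v, w)` at `x`, computed in the chart around `x₀`, whose
domain must contain `x`. The value does not depend on `x₀`. -/
def QuadraticDifferential.nabla (σ : QuadraticDifferential J) (x₀ x : S) (u v w : Tan x) : ℂ :=
  ∑ k, ∑ i, ∑ j, ((comp x₀ x u k * comp x₀ x v i * comp x₀ x w j : ℝ) : ℂ) *
    σ.nablaComp x₀ k i j (extChartAt (𝓡 2) x₀ x)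

/-- `(∂_J σ)(u) = (∇_u σ - i ∇_{Ju} σ) / 2`. -/
def QuadraticDifferential.del (σ : QuadraticDifferential J) (x₀ x : S) (u v w : Tan x) : ℂ :=
  (1 / 2) * (σ.nabla x₀ x u v w - Complex.I * σ.nabla x₀ x (J.J x u) v w)

/-- `(∂̄_J σ)(u) = (∇_u σ + i ∇_{Ju} σ) / 2`. -/
def QuadraticDifferential.dbar (σ : QuadraticDifferential J) (x₀ x : S) (u v w : Tan x) : ℂ :=
  (1 / 2) * (σ.nabla x₀ x u v w + Complex.I * σ.nabla x₀ x (J.J x u) v w)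

/-- The equation `∂̄_J σ = 0`, stated at every point in every chart `chartAt _ x₀` that contains
this point. As `∂̄_J σ` is a tensor, one chart around each point is equivalent. -/
def QuadraticDifferential.IsHolomorphic (σ : QuadraticDifferential J) : Prop :=
  ∀ x₀ x : S, x ∈ (extChartAt (𝓡 2) x₀).source → ∀ u v w : Tan x, σ.dbar x₀ x u v w = 0

variable (J) in
/-- The pointwise norm `|τ|_J = |τ(u)|_J` (`u` a `g`-unit vector) of a form `τ` of type `(1,0)`
or `(0,1)` with values in the quadratic differentials. All unit vectors `u`, `v` give the same
value `|τ(u)(v,v)|`, so the supremum is over a single number. -/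
def formNorm (x : S) (τ : Tan x → Tan x → Tan x → ℂ) : ℝ :=
  sSup {r : ℝ | ∃ u v : Tan x, J.metric x u u = 1 ∧ J.metric x v v = 1 ∧ r = ‖τ u v v‖}

end Geometry

section Constant

variable {S : Type*} [TopologicalSpace S] [ChartedSpace Plane S]

/-- The total area `vol(S, ρ) = ∫_S ρ > 0`, for the orientation given by `ρ`, through a smooth
partition of unity subordinate to the charts. -/
def AreaForm.vol [IsManifold (𝓡 2) ∞ S] [T2Space S] [SigmaCompactSpace S] (ρ : AreaForm S) : ℝ :=
  let f := (SmoothPartitionOfUnity.exists_isSubordinate_chartAt_source (𝓡 2) S).choose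
  ∑ᶠ x₀ : S, ∫ y in (extChartAt (𝓡 2) x₀).target,
    f x₀ (chartInv x₀ y) * |ρ.form (chartInv x₀ y) (coordVec x₀ y 0) (coordVec x₀ y 1)|

end Constant

/-- The genus of a closed oriented surface: half the dimension of `H_1(S; ℚ)`. -/
def genus.{u} (S : Type u) [TopologicalSpace S] : ℕ :=
  Module.finrank ℚ ((((AlgebraicTopology.singularHomologyFunctor (ModuleCat.{u} ℚ) 1).obj
    (ModuleCat.of ℚ (ULift.{u} ℚ))).obj (TopCat.of S) : ModuleCat.{u} ℚ)) / 2

section Moduli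

variable {S : Type*} [TopologicalSpace S] [ChartedSpace Plane S]

/-- The constant `c = 2π(2 - 2 genus(S)) / vol(S, ρ)`. -/
def AreaForm.c [IsManifold (𝓡 2) ∞ S] [T2Space S] [SigmaCompactSpace S] (ρ : AreaForm S) : ℝ :=
  2 * Real.pi * (2 - 2 * (genus S : ℝ)) / ρ.vol

/-- The first moment map, a (complex-valued) `2`-form on `S`:
`(|∂σ|² - |∂̄σ|²) / √(1 - |σ|²) ρ - 2 √(1 - |σ|²) K_J ρ - 2i ∂̄∂ √(1 - |σ|²) + 2cρ`. -/
def mu₁ [IsManifold (𝓡 2) ∞ S] [T2Space S] [SigmaCompactSpace S] {ρ : AreaForm S}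
    (J : ComplexStructure ρ) (σ : QuadraticDifferential J) (x : S) (u v : Tan x) : ℂ :=
  (((formNorm J x (σ.del x x) ^ 2 - formNorm J x (σ.dbar x x) ^ 2) / Real.sqrt (1 - σ.norm x ^ 2)
      * ρ.form x u v : ℝ) : ℂ)
    - ((2 * Real.sqrt (1 - σ.norm x ^ 2) * J.gaussCurvature x * ρ.form x u v : ℝ) : ℂ)
    - 2 * Complex.I * J.dbarDel (fun z => Real.sqrt (1 - σ.norm z ^ 2)) x u v
    + ((2 * ρ.c * ρ.form x u v : ℝ) : ℂ)

/-- The space `𝒬(S)` of pairs `(J, σ)` with `J ∈ 𝒥(S)` and `σ ∈ Q(J)`. -/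
structure QPair (ρ : AreaForm S) where
  J : ComplexStructure ρ
  σ : QuadraticDifferential J

/-- `φ^* ρ = ρ`. -/
def IsSymplectic (ρ : AreaForm S) (φ : S ≃ₘ⟮𝓡 2, 𝓡 2⟯ S) : Prop :=
  ∀ (x : S) (u v : Tan x),
    ρ.form (φ x) (mfderiv (𝓡 2) (𝓡 2) φ x u) (mfderiv (𝓡 2) (𝓡 2) φ x v) = ρ.form x u v

/-- `Symp₀(S, ρ)`: the symplectomorphisms that are joined to the identity by a smooth path of
symplectomorphisms. -/
def Symp₀ (ρ : AreaForm S) : Set (S ≃ₘ⟮𝓡 2, 𝓡 2⟯ S) :=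
  {φ | ∃ Φ : ℝ → (S ≃ₘ⟮𝓡 2, 𝓡 2⟯ S),
    ContMDiff (𝓘(ℝ, ℝ).prod (𝓡 2)) (𝓡 2) ∞ (fun p : ℝ × S => Φ p.1 p.2) ∧
    (∀ t, IsSymplectic ρ (Φ t)) ∧ Φ 0 = Diffeomorph.refl (𝓡 2) S ∞ ∧ Φ 1 = φ}

/-- `p' = φ^* p`, that is `J' = dφ⁻¹ ∘ J ∘ dφ` and `σ' = σ(dφ ·, dφ ·)`. -/
def IsPullback {ρ : AreaForm S} (φ : S ≃ₘ⟮𝓡 2, 𝓡 2⟯ S) (p p' : QPair ρ) : Prop :=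
  (∀ (x : S) (u : Tan x), mfderiv (𝓡 2) (𝓡 2) φ x (p'.J.J x u)
      = p.J.J (φ x) (mfderiv (𝓡 2) (𝓡 2) φ x u)) ∧
  (∀ (x : S) (u v : Tan x), p'.σ.q x u v
      = p.σ.q (φ x) (mfderiv (𝓡 2) (𝓡 2) φ x u) (mfderiv (𝓡 2) (𝓡 2) φ x v))

/-- The quotient `𝒬(S) / Symp₀(S, ρ)`. -/
def QuotientBySymp₀ (ρ : AreaForm S) : Type _ :=
  Quot fun p p' : QPair ρ => ∃ φ ∈ Symp₀ ρ, IsPullback φ p p'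

/-- The class of a pair `(J, σ)` modulo `Symp₀(S, ρ)`. -/
def QPair.mk₀ {ρ : AreaForm S} (p : QPair ρ) : QuotientBySymp₀ ρ := Quot.mk _ p

/-- The moduli space
`ℳ_s = {(J, σ) ∈ 𝒬(S) | μ₁(J, σ) = 0, ∂̄_J σ = 0, |σ| < 1} / Symp₀(S, ρ)`. -/
def moduliSpace [IsManifold (𝓡 2) ∞ S] [T2Space S] [SigmaCompactSpace S] (ρ : AreaForm S) :
    Set (QuotientBySymp₀ ρ) :=
  QPair.mk₀ '' {p | (∀ (x : S) (u v : Tan x), mu₁ p.J p.σ x u v = 0) ∧ p.σ.IsHolomorphic ∧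
    ∀ x, p.σ.norm x < 1}

end Moduli

end AlmostFuchsian

end

/-!
The asserted formula for the moment map is a pointwise identity between second order expressions, so
it is proved in a chart around each point; the equality of the moduli spaces follows because the
area form vanishes nowhere.

No isothermal coordinates are used. In an arbitrary chart, let `θ = dx + μ dy` be the `(1,0)`-form of
`J` with `θ(∂₀) = 1`. Then `g = λ |θ|²` and `σ = Q θ²`, with a positive function `λ` and complex
functions `μ`, `Q` (`ComplexStructure.gram_eq`, `QuadraticDifferential.q_coordVec`). The Levi-Civita
connection is encoded by a single complex-valued one-form `η` with `∇θ = -η ⊗ θ`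
(`PlaneConformal.theta_christoffel`), and the Gaussian curvature `K` is read off from the purely
imaginary form `dη` (`PlaneConformal.theta_riemann`, `PlaneConformal.gauss_eq`). The covariant
derivative of `σ` is `N ⊗ θ²` with `N = dQ - 2Qη`; it satisfies `∂̄σ = 0` exactly if `N = N₀ θ`
(`PlaneConformal.nabla_eq`, `QuadraticDifferential.cov_one`).

For holomorphic `σ` put `s = |σ|²`. The `(1,0)`-part of `ds` is `conj Q · N₀ λ⁻² θ`, which gives
`|ds|² = 4 s |∂σ|²` (`PlaneConformal.flux_normSq_dot`), and the integrability condition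
`dN = 2η ∧ N - 2Q dη` gives the Bochner formula `Δs = -4 |∂σ|² - 4 K s`
(`PlaneConformal.divFlux_normSq`). On functions, `2i ∂̄∂f = Δf ρ` (`ComplexStructure.dbarDel_eq`).
With `w = √(1 - s)`, the chain rule applied to `log (1 + w) - w` as a function of `s` yields
`Δ(log (1 + w) - w) = -2K (1 - w) - |∂σ|² / w`, which is the claim
(`PlaneConformal.momentMap_eq`, `mu₁_eq`).
-/

noncomputable section

namespace AlmostFuchsian

/-! ### Partial derivatives of functions on the plane -/

section PartialDerivatives

variable {F : Type*} [NormedAddCommGroup F] [NormedSpace ℝ F]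
  {F' : Type*} [NormedAddCommGroup F'] [NormedSpace ℝ F']
  {A : Type*} [NormedCommRing A] [NormedAlgebra ℝ A]
  {U : Set Plane} {y : Plane} {i : Fin 2}

lemma _root_.ContDiffOn.differentiableAt_of_isOpen {f : Plane → F} (hf : ContDiffOn ℝ ∞ f U)
    (hU : IsOpen U) (hy : y ∈ U) : DifferentiableAt ℝ f y :=
  (hf.contDiffAt (hU.mem_nhds hy)).differentiableAt (by simp)

lemma _root_.ContDiffOn.pd {f : Plane → F} (hf : ContDiffOn ℝ ∞ f U) (hU : IsOpen U)
    (i : Fin 2) : ContDiffOn ℝ ∞ (pd i f) U :=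
  (hf.fderiv_of_isOpen hU (by simp)).clm_apply contDiffOn_const

lemma pd_congr {f g : Plane → F} (hU : IsOpen U) (hy : y ∈ U) (h : Set.EqOn f g U) :
    pd i f y = pd i g y := by
  unfold pd
  rw [(h.eventuallyEq_of_mem (hU.mem_nhds hy)).fderiv_eq]

lemma pd_const (c : F) : pd i (fun _ => c) y = 0 := by simp [pd]

lemma pd_add {f g : Plane → F} (hf : DifferentiableAt ℝ f y) (hg : DifferentiableAt ℝ g y) :
    pd i (fun z => f z + g z) y = pd i f y + pd i g y := by
  simp [pd, fderiv_fun_add hf hg]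

lemma pd_sub {f g : Plane → F} (hf : DifferentiableAt ℝ f y) (hg : DifferentiableAt ℝ g y) :
    pd i (fun z => f z - g z) y = pd i f y - pd i g y := by
  simp [pd, fderiv_fun_sub hf hg]

lemma pd_mul {f g : Plane → A} (hf : DifferentiableAt ℝ f y) (hg : DifferentiableAt ℝ g y) :
    pd i (fun z => f z * g z) y = pd i f y * g y + f y * pd i g y := by
  simp [pd, fderiv_fun_mul hf hg]
  ring

lemma pd_const_mul {f : Plane → A} (c : A) (hf : DifferentiableAt ℝ f y) :
    pd i (fun z => c * f z) y = c * pd i f y := by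
  rw [pd_mul (differentiableAt_const c) hf, pd_const]
  ring

lemma pd_sum {ι : Type*} (s : Finset ι) {f : ι → Plane → F}
    (hf : ∀ k ∈ s, DifferentiableAt ℝ (f k) y) :
    pd i (fun z => ∑ k ∈ s, f k z) y = ∑ k ∈ s, pd i (f k) y := by
  simp [pd, fderiv_fun_sum hf]

lemma pd_clm (L : F →L[ℝ] F') {f : Plane → F} (hf : DifferentiableAt ℝ f y) :
    pd i (fun z => L (f z)) y = L (pd i f y) := by
  have := (L.hasFDerivAt.comp y hf.hasFDerivAt).fderiv
  simp only [pd]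
  change fderiv ℝ (L ∘ f) y _ = _
  rw [this]
  rfl

lemma pd_ofReal {f : Plane → ℝ} (hf : DifferentiableAt ℝ f y) :
    pd i (fun z => (f z : ℂ)) y = ((pd i f y : ℝ) : ℂ) :=
  pd_clm Complex.ofRealCLM hf

lemma pd_re {f : Plane → ℂ} (hf : DifferentiableAt ℝ f y) :
    pd i (fun z => (f z).re) y = (pd i f y).re :=
  pd_clm Complex.reCLM hf

lemma pd_im {f : Plane → ℂ} (hf : DifferentiableAt ℝ f y) :
    pd i (fun z => (f z).im) y = (pd i f y).im :=
  pd_clm Complex.imCLM hf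

lemma pd_conj {f : Plane → ℂ} (hf : DifferentiableAt ℝ f y) :
    pd i (fun z => (starRingEnd ℂ) (f z)) y = (starRingEnd ℂ) (pd i f y) :=
  pd_clm (Complex.conjCLE : ℂ →L[ℝ] ℂ) hf

lemma pd_comp {f : Plane → ℝ} {φ : ℝ → ℝ} {d : ℝ} (hφ : HasDerivAt φ d (f y))
    (hf : DifferentiableAt ℝ f y) : pd i (fun z => φ (f z)) y = d * pd i f y := by
  have := (hφ.comp_hasFDerivAt y hf.hasFDerivAt).fderiv
  simp only [pd]
  change fderiv ℝ (φ ∘ f) y _ = _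
  rw [this]
  simp

lemma pd_comm {f : Plane → F} (hf : ContDiffOn ℝ ∞ f U) (hU : IsOpen U) (hy : y ∈ U)
    (i j : Fin 2) : pd i (pd j f) y = pd j (pd i f) y := by
  have h := (hf.contDiffAt (hU.mem_nhds hy)).isSymmSndFDerivAt
    (by simpa using ENat.LEInfty.out)
  have hd : DifferentiableAt ℝ (fderiv ℝ f) y :=
    (hf.fderiv_of_isOpen hU (m := ∞) (by simp)).differentiableAt_of_isOpen hU hy
  have key : ∀ a b : Fin 2, pd a (pd b f) y
      = fderiv ℝ (fderiv ℝ f) y (EuclideanSpace.single a 1) (EuclideanSpace.single b 1) := by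
    intro a b
    unfold pd
    rw [fderiv_clm_apply hd (differentiableAt_const _)]
    simp
  rw [key, key]
  exact h _ _

end PartialDerivatives

/-! ### Metrics on the plane and their connection form -/

/-- A metric `λ |dx + μ dy|²` on an open set `U` of the plane, with `λ > 0` and `μ = p + i m`,
`m ≠ 0`. Every Riemannian metric has this form, and `dx + μ dy` is a `(1,0)`-form for the complex
structure it induces. Both signs of `m` are allowed, as charts need not preserve orientation. -/
structure PlaneConformal where
  U : Set Plane
  isOpen : IsOpen U
  lam : Plane → ℝ
  p : Plane → ℝ
  m : Plane → ℝ
  lam_smooth : ContDiffOn ℝ ∞ lam U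
  p_smooth : ContDiffOn ℝ ∞ p U
  m_smooth : ContDiffOn ℝ ∞ m U
  lam_pos : ∀ y ∈ U, 0 < lam y
  m_ne : ∀ y ∈ U, m y ≠ 0

/-- The Christoffel symbols `Γ^k_{ij}` of a metric on the plane. -/
def planeChristoffel (G : Plane → Matrix (Fin 2) (Fin 2) ℝ) (k i j : Fin 2) (y : Plane) : ℝ :=
  (1 / 2) * ∑ l, (G y)⁻¹ k l *
    (pd i (fun z => G z j l) y + pd j (fun z => G z i l) y - pd l (fun z => G z i j) y)

namespace PlaneConformal

variable (C : PlaneConformal) {y : Plane}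

/-- The Gram matrix of the metric `λ |dx + μ dy|²`. -/
def gram (y : Plane) : Matrix (Fin 2) (Fin 2) ℝ :=
  !![C.lam y, C.lam y * C.p y; C.lam y * C.p y, C.lam y * (C.p y ^ 2 + C.m y ^ 2)]

/-- The complex function `μ = p + i m`. -/
def mu (y : Plane) : ℂ := C.p y + C.m y * Complex.I

/-- The components of the `(1,0)`-form `θ = dx + μ dy`. -/
def theta : Fin 2 → Plane → ℂ := ![fun _ => 1, C.mu]

/-- The imaginary part of the component `η₀` of the connection form. With `Re η = d (log λ) / 2`
it is determined by the structure equation `dθ = -η ∧ θ`. -/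
def rot (y : Plane) : ℝ :=
  (2 * pd 0 C.p y + (C.p y * pd 0 C.lam y - pd 1 C.lam y) / C.lam y) / (2 * C.m y)

/-- The imaginary parts of the components of the connection form. -/
def etaIm : Fin 2 → Plane → ℝ :=
  ![C.rot, fun y => C.p y * C.rot y + C.m y * pd 0 C.lam y / (2 * C.lam y) + pd 0 C.m y]

/-- The components of the connection form `η` of `θ`, given by `∇θ = -η ⊗ θ`. The real part is
`d (log λ) / 2`, because `λ |θ|²` is parallel. -/
def eta (i : Fin 2) (y : Plane) : ℂ :=
  ((pd i C.lam y / (2 * C.lam y) : ℝ) : ℂ) + (C.etaIm i y : ℂ) * Complex.I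

/-- The real function `k` with `dη = i k dx ∧ dy`. -/
def curv (y : Plane) : ℝ := pd 0 (C.etaIm 1) y - pd 1 (C.etaIm 0) y

variable {C}

lemma lam_ne (hy : y ∈ C.U) : C.lam y ≠ 0 := (C.lam_pos y hy).ne'

lemma contDiffOn_ofReal {f : Plane → ℝ} {U : Set Plane} (hf : ContDiffOn ℝ ∞ f U) :
    ContDiffOn ℝ ∞ (fun y => (f y : ℂ)) U :=
  Complex.ofRealCLM.contDiff.comp_contDiffOn hf

lemma mu_smooth : ContDiffOn ℝ ∞ C.mu C.U :=
  (contDiffOn_ofReal C.p_smooth).add ((contDiffOn_ofReal C.m_smooth).mul contDiffOn_const)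

lemma theta_smooth (i : Fin 2) : ContDiffOn ℝ ∞ (C.theta i) C.U := by
  fin_cases i
  · exact contDiffOn_const
  · exact mu_smooth

lemma rot_smooth : ContDiffOn ℝ ∞ C.rot C.U := by
  have h0 := C.lam_smooth.pd C.isOpen 0
  have h1 := C.lam_smooth.pd C.isOpen 1
  have h2 := C.p_smooth.pd C.isOpen 0
  exact ((contDiffOn_const.mul h2).add (((C.p_smooth.mul h0).sub h1).div C.lam_smooth
    fun y hy => lam_ne hy)).div (contDiffOn_const.mul C.m_smooth)
    fun y hy => mul_ne_zero two_ne_zero (C.m_ne y hy)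

lemma etaIm_smooth (i : Fin 2) : ContDiffOn ℝ ∞ (C.etaIm i) C.U := by
  fin_cases i
  · exact rot_smooth
  · exact ((C.p_smooth.mul rot_smooth).add ((C.m_smooth.mul (C.lam_smooth.pd C.isOpen 0)).div
      (contDiffOn_const.mul C.lam_smooth) fun y hy => mul_ne_zero two_ne_zero (lam_ne hy))).add
      (C.m_smooth.pd C.isOpen 0)

lemma etaRe_smooth (i : Fin 2) :
    ContDiffOn ℝ ∞ (fun y => pd i C.lam y / (2 * C.lam y)) C.U :=
  (C.lam_smooth.pd C.isOpen i).div (contDiffOn_const.mul C.lam_smooth)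
    fun _ hy => mul_ne_zero two_ne_zero (lam_ne hy)

lemma eta_smooth (i : Fin 2) : ContDiffOn ℝ ∞ (C.eta i) C.U :=
  (contDiffOn_ofReal (etaRe_smooth i)).add
    ((contDiffOn_ofReal (etaIm_smooth i)).mul contDiffOn_const)

lemma pd_mu (hy : y ∈ C.U) (i : Fin 2) :
    pd i C.mu y = ((pd i C.p y : ℝ) : ℂ) + ((pd i C.m y : ℝ) : ℂ) * Complex.I := by
  have hp := C.p_smooth.differentiableAt_of_isOpen C.isOpen hy
  have hm := C.m_smooth.differentiableAt_of_isOpen C.isOpen hy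
  have hp' := (contDiffOn_ofReal C.p_smooth).differentiableAt_of_isOpen C.isOpen hy
  have hm' := (contDiffOn_ofReal C.m_smooth).differentiableAt_of_isOpen C.isOpen hy
  unfold mu
  rw [pd_add hp' (hm'.mul_const _), pd_mul hm' (differentiableAt_const _), pd_const,
    pd_ofReal hp, pd_ofReal hm]
  ring

lemma mu_re : (C.mu y).re = C.p y := by simp [mu]

lemma mu_im : (C.mu y).im = C.m y := by simp [mu]

lemma eta_re (i : Fin 2) : (C.eta i y).re = pd i C.lam y / (2 * C.lam y) := by
  rw [eta, Complex.add_re, Complex.ofReal_re]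
  simp

lemma eta_im (i : Fin 2) : (C.eta i y).im = C.etaIm i y := by
  rw [eta, Complex.add_im, Complex.ofReal_im]
  simp

lemma pd_mu_re (hy : y ∈ C.U) (i : Fin 2) : (pd i C.mu y).re = pd i C.p y := by
  simp [pd_mu hy]

lemma pd_mu_im (hy : y ∈ C.U) (i : Fin 2) : (pd i C.mu y).im = pd i C.m y := by
  simp [pd_mu hy]

lemma etaIm_zero : C.etaIm 0 y = C.rot y := rfl

lemma etaIm_one : C.etaIm 1 y = C.p y * C.rot y
    + C.m y * pd 0 C.lam y / (2 * C.lam y) + pd 0 C.m y := rfl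

lemma theta_zero : C.theta 0 = fun _ => 1 := rfl

lemma theta_one : C.theta 1 = C.mu := rfl

lemma inv_gram (hy : y ∈ C.U) : (C.gram y)⁻¹ =
    !![(C.p y ^ 2 + C.m y ^ 2) / (C.lam y * C.m y ^ 2), - C.p y / (C.lam y * C.m y ^ 2);
      - C.p y / (C.lam y * C.m y ^ 2), 1 / (C.lam y * C.m y ^ 2)] := by
  have hl := lam_ne hy
  have hm := C.m_ne y hy
  apply Matrix.inv_eq_right_inv
  ext i j
  fin_cases i <;> fin_cases j <;> simp [gram, Matrix.mul_apply] <;> field_simp <;> ring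

lemma det_gram : (C.gram y).det = C.lam y ^ 2 * C.m y ^ 2 := by
  simp [gram, Matrix.det_fin_two]
  ring

lemma pd_gram (hy : y ∈ C.U) (k : Fin 2) :
    pd k (fun z => C.gram z 0 0) y = pd k C.lam y ∧
    pd k (fun z => C.gram z 0 1) y = pd k C.lam y * C.p y + C.lam y * pd k C.p y ∧
    pd k (fun z => C.gram z 1 0) y = pd k C.lam y * C.p y + C.lam y * pd k C.p y ∧
    pd k (fun z => C.gram z 1 1) y = pd k C.lam y * (C.p y ^ 2 + C.m y ^ 2)
      + C.lam y * (2 * C.p y * pd k C.p y + 2 * C.m y * pd k C.m y) := by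
  have hp := C.p_smooth.differentiableAt_of_isOpen C.isOpen hy
  have hm := C.m_smooth.differentiableAt_of_isOpen C.isOpen hy
  have hl := C.lam_smooth.differentiableAt_of_isOpen C.isOpen hy
  refine ⟨rfl, pd_mul hl hp, pd_mul hl hp, ?_⟩
  have e : (fun z => C.gram z 1 1) = fun z => C.lam z * (C.p z * C.p z + C.m z * C.m z) := by
    funext z
    change C.lam z * (C.p z ^ 2 + C.m z ^ 2) = _
    ring
  rw [e, pd_mul hl ((hp.fun_mul hp).fun_add (hm.fun_mul hm)),
    pd_add (hp.fun_mul hp) (hm.fun_mul hm), pd_mul hp hp, pd_mul hm hm]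
  ring

/-- The Levi-Civita connection acts on `θ` by `∇θ = -η ⊗ θ`. -/
lemma theta_christoffel {G : Plane → Matrix (Fin 2) (Fin 2) ℝ} (hG : Set.EqOn G C.gram C.U)
    (hy : y ∈ C.U) (k i : Fin 2) :
    ∑ l, C.theta l y * (planeChristoffel G l k i y : ℂ)
      = pd k (C.theta i) y + C.eta k y * C.theta i y := by
  have hl := lam_ne hy
  have hm := C.m_ne y hy
  have e : ∀ a b c, pd a (fun z => G z b c) y = pd a (fun z => C.gram z b c) y := fun a b c =>
    pd_congr C.isOpen hy fun z hz => by simp only [hG hz]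
  obtain ⟨a0, a1, a2, a3⟩ := pd_gram hy 0
  obtain ⟨b0, b1, b2, b3⟩ := pd_gram hy 1
  have hre : ∀ a b c, (planeChristoffel G a b c y : ℂ).re = planeChristoffel G a b c y :=
    fun _ _ _ => rfl
  have him : ∀ a b c, (planeChristoffel G a b c y : ℂ).im = 0 := fun _ _ _ => rfl
  have c0 : ∀ k, pd k (fun _ : Plane => (1 : ℂ)) y = 0 := fun _ => pd_const _
  revert k i
  simp only [Fin.forall_fin_two, Fin.sum_univ_two, theta_zero, theta_one, Complex.ext_iff, c0,
    Complex.add_re, Complex.add_im, Complex.mul_re, Complex.mul_im, mu_re, mu_im,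
    eta_re, eta_im, pd_mu_re hy, pd_mu_im hy, hre, him, Complex.one_re, Complex.one_im,
    Complex.zero_re, Complex.zero_im]
  simp only [planeChristoffel, hG hy, e, inv_gram hy, Fin.sum_univ_two, Matrix.of_apply,
    Matrix.cons_val', Matrix.cons_val_zero, Matrix.cons_val_one, Matrix.cons_val_fin_one,
    a0, a1, a2, a3, b0, b1, b2, b3, etaIm_zero, etaIm_one, rot]
  refine ⟨⟨⟨?_, ?_⟩, ⟨?_, ?_⟩⟩, ⟨⟨?_, ?_⟩, ⟨?_, ?_⟩⟩⟩ <;> field_simp <;> ring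

end PlaneConformal

/-! ### Curvature and covariant derivatives -/

/-- The components `R^l` of the curvature tensor `R(∂_i, ∂_j) ∂_k` of a metric on the plane. -/
def planeRiemann (G : Plane → Matrix (Fin 2) (Fin 2) ℝ) (l i j k : Fin 2) (y : Plane) : ℝ :=
  pd i (planeChristoffel G l j k) y - pd j (planeChristoffel G l i k) y
    + ∑ m, (planeChristoffel G m j k y * planeChristoffel G l i m y
      - planeChristoffel G m i k y * planeChristoffel G l j m y)

namespace PlaneConformal

variable {C : PlaneConformal} {y : Plane} {G : Plane → Matrix (Fin 2) (Fin 2) ℝ}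

lemma contDiffOn_re {f : Plane → ℂ} {U : Set Plane} (hf : ContDiffOn ℝ ∞ f U) :
    ContDiffOn ℝ ∞ (fun y => (f y).re) U :=
  Complex.reCLM.contDiff.comp_contDiffOn hf

lemma contDiffOn_im {f : Plane → ℂ} {U : Set Plane} (hf : ContDiffOn ℝ ∞ f U) :
    ContDiffOn ℝ ∞ (fun y => (f y).im) U :=
  Complex.imCLM.contDiff.comp_contDiffOn hf

lemma christoffel_smooth (hG : Set.EqOn G C.gram C.U) (l k i : Fin 2) :
    ContDiffOn ℝ ∞ (planeChristoffel G l k i) C.U := by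
  have hc : ContDiffOn ℝ ∞ (fun y => pd k (C.theta i) y + C.eta k y * C.theta i y) C.U :=
    ((theta_smooth i).pd C.isOpen k).add ((eta_smooth k).mul (theta_smooth i))
  -- the Christoffel symbols are recovered from `∑ θ_l Γ^l_{ki}` since `Im μ ≠ 0`
  have h1 : ∀ y ∈ C.U, planeChristoffel G 1 k i y
      = (pd k (C.theta i) y + C.eta k y * C.theta i y).im / C.m y := by
    intro y hy
    have hm := C.m_ne y hy
    rw [← theta_christoffel hG hy, eq_div_iff hm]
    simp [Fin.sum_univ_two, theta_zero, theta_one, mu_im, mul_comm]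
  have h0 : ∀ y ∈ C.U, planeChristoffel G 0 k i y
      = (pd k (C.theta i) y + C.eta k y * C.theta i y).re
        - C.p y * ((pd k (C.theta i) y + C.eta k y * C.theta i y).im / C.m y) := by
    intro y hy
    rw [← h1 y hy, ← theta_christoffel hG hy]
    simp [Fin.sum_univ_two, theta_zero, theta_one, mu_re]
  have s1 := (contDiffOn_im hc).div C.m_smooth C.m_ne
  fin_cases l
  · exact ((contDiffOn_re hc).sub (C.p_smooth.mul s1)).congr h0
  · exact s1.congr h1

/-- The curvature of the line bundle spanned by `θ` is `dη`. -/
lemma theta_riemann (hG : Set.EqOn G C.gram C.U) (hy : y ∈ C.U) (i j k : Fin 2) :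
    ∑ l, C.theta l y * (planeRiemann G l i j k y : ℂ)
      = (pd i (C.eta j) y - pd j (C.eta i) y) * C.theta k y := by
  have dθ : ∀ k, DifferentiableAt ℝ (C.theta k) y := fun k =>
    (theta_smooth k).differentiableAt_of_isOpen C.isOpen hy
  have dη : ∀ k, DifferentiableAt ℝ (C.eta k) y := fun k =>
    (eta_smooth k).differentiableAt_of_isOpen C.isOpen hy
  have dpθ : ∀ j k, DifferentiableAt ℝ (pd j (C.theta k)) y := fun j k =>
    ((theta_smooth k).pd C.isOpen j).differentiableAt_of_isOpen C.isOpen hy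
  have dΓ : ∀ l j k, DifferentiableAt ℝ (planeChristoffel G l j k) y := fun l j k =>
    (christoffel_smooth hG l j k).differentiableAt_of_isOpen C.isOpen hy
  have dΓ' : ∀ l j k, DifferentiableAt ℝ (fun z => (planeChristoffel G l j k z : ℂ)) y :=
    fun l j k => (contDiffOn_ofReal (christoffel_smooth hG l j k)).differentiableAt_of_isOpen
      C.isOpen hy
  have H := theta_christoffel hG hy
  have D : ∀ i j k, ∑ l, (pd i (C.theta l) y * (planeChristoffel G l j k y : ℂ)
      + C.theta l y * ((pd i (planeChristoffel G l j k) y : ℝ) : ℂ))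
      = pd i (pd j (C.theta k)) y + (pd i (C.eta j) y * C.theta k y
        + C.eta j y * pd i (C.theta k) y) := by
    intro i j k
    have := pd_congr (i := i) C.isOpen hy fun z hz => theta_christoffel hG hz j k
    rw [pd_add (dpθ j k) ((dη j).fun_mul (dθ k)), pd_mul (dη j) (dθ k),
      pd_sum _ fun l _ => (dθ l).fun_mul (dΓ' l j k)] at this
    rw [← this]
    refine Finset.sum_congr rfl fun l _ => ?_
    rw [pd_mul (dθ l) (dΓ' l j k), pd_ofReal (dΓ l j k)]
  have D1 := D i j k
  have D2 := D j i k
  have S := pd_comm (theta_smooth (C := C) k) C.isOpen hy i j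
  have H1 := H i 0
  have H2 := H i 1
  have H3 := H j 0
  have H4 := H j 1
  have H5 := H j k
  have H6 := H i k
  simp only [planeRiemann, Fin.sum_univ_two] at *
  push_cast
  linear_combination D1 - D2 + S + (planeChristoffel G 0 j k y : ℂ) * H1
    + (planeChristoffel G 1 j k y : ℂ) * H2 - (planeChristoffel G 0 i k y : ℂ) * H3
    - (planeChristoffel G 1 i k y : ℂ) * H4 + C.eta i y * H5 - C.eta j y * H6

/-- The curvature form `dη` is purely imaginary. -/
lemma curv_re (hy : y ∈ C.U) : (pd 0 (C.eta 1) y - pd 1 (C.eta 0) y).re = 0 := by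
  have dη : ∀ k, DifferentiableAt ℝ (C.eta k) y := fun k =>
    (eta_smooth k).differentiableAt_of_isOpen C.isOpen hy
  have hL : ContDiffOn ℝ ∞ (fun z => Real.log (C.lam z)) C.U :=
    C.lam_smooth.log fun z hz => lam_ne hz
  -- the real part of `η` is the exact form `d (log λ) / 2`
  have e : ∀ j, Set.EqOn (fun z => (C.eta j z).re)
      (fun z => (1 / 2) * pd j (fun z => Real.log (C.lam z)) z) C.U := by
    intro j z hz
    have hl := lam_ne hz
    simp only [eta_re]
    rw [pd_comp (Real.hasDerivAt_log hl) (C.lam_smooth.differentiableAt_of_isOpen C.isOpen hz)]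
    field_simp
  have d : ∀ j, DifferentiableAt ℝ (pd j (fun z => Real.log (C.lam z))) y := fun j =>
    (hL.pd C.isOpen j).differentiableAt_of_isOpen C.isOpen hy
  rw [Complex.sub_re, ← pd_re (dη 1), ← pd_re (dη 0), pd_congr C.isOpen hy (e 0),
    pd_congr C.isOpen hy (e 1), pd_const_mul _ (d 0), pd_const_mul _ (d 1),
    pd_comm hL C.isOpen hy 0 1, sub_self]

lemma curv_eq (hy : y ∈ C.U) :
    pd 0 (C.eta 1) y - pd 1 (C.eta 0) y = (C.curv y : ℂ) * Complex.I := by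
  have dη : ∀ k, DifferentiableAt ℝ (C.eta k) y := fun k =>
    (eta_smooth k).differentiableAt_of_isOpen C.isOpen hy
  have e : ∀ j, C.etaIm j = fun z => (C.eta j z).im := fun j => by
    funext z
    exact eta_im j |>.symm
  apply Complex.ext
  · rw [curv_re hy]
    simp
  · rw [curv, e 0, e 1, pd_im (dη 0), pd_im (dη 1)]
    simp

/-- The Gaussian curvature is `-k / (λ m)`, where `dη = i k dx ∧ dy`. -/
lemma gauss_eq (hG : Set.EqOn G C.gram C.U) (hy : y ∈ C.U) :
    (∑ l, G y l 0 * planeRiemann G l 0 1 1 y) / (G y).det = - C.curv y / (C.lam y * C.m y) := by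
  have hl := lam_ne hy
  have hm := C.m_ne y hy
  have h := congrArg Complex.re (theta_riemann hG hy 0 1 1)
  rw [curv_eq hy] at h
  simp only [Fin.sum_univ_two, theta_zero, theta_one, Complex.add_re,
    Complex.mul_re, Complex.mul_im, Complex.I_re, Complex.I_im, Complex.ofReal_re,
    Complex.ofReal_im, mu_re, mu_im, Complex.one_re] at h
  rw [hG hy, det_gram]
  simp only [Fin.sum_univ_two, gram, Matrix.of_apply,
    Matrix.cons_val', Matrix.cons_val_zero, Matrix.cons_val_one, Matrix.cons_val_fin_one]
  field_simp
  linear_combination h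

/-- The components of the covariant derivative of a symmetric bilinear form on the plane. -/
def _root_.AlmostFuchsian.planeNabla (G : Plane → Matrix (Fin 2) (Fin 2) ℝ)
    (q : Fin 2 → Fin 2 → Plane → ℂ) (k i j : Fin 2) (y : Plane) : ℂ :=
  pd k (q i j) y - ∑ l, (planeChristoffel G l k i y : ℂ) * q l j y
    - ∑ l, (planeChristoffel G l k j y : ℂ) * q i l y

variable (C) in
/-- The coefficients `N_k` of `∇(Q θ²) = N ⊗ θ²`. -/
def cov (Q : Plane → ℂ) (k : Fin 2) (y : Plane) : ℂ := pd k Q y - 2 * C.eta k y * Q y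

lemma nabla_eq (hG : Set.EqOn G C.gram C.U) {Q : Plane → ℂ} (hQ : ContDiffOn ℝ ∞ Q C.U)
    {q : Fin 2 → Fin 2 → Plane → ℂ}
    (hq : ∀ i j, Set.EqOn (q i j) (fun z => Q z * (C.theta i z * C.theta j z)) C.U)
    (hy : y ∈ C.U) (k i j : Fin 2) :
    planeNabla G q k i j y = C.cov Q k y * (C.theta i y * C.theta j y) := by
  have dθ : ∀ k, DifferentiableAt ℝ (C.theta k) y := fun k =>
    (theta_smooth k).differentiableAt_of_isOpen C.isOpen hy
  have dQ := hQ.differentiableAt_of_isOpen C.isOpen hy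
  have H1 := theta_christoffel hG hy k i
  have H2 := theta_christoffel hG hy k j
  rw [planeNabla, pd_congr C.isOpen hy (hq i j), pd_mul dQ ((dθ i).fun_mul (dθ j)),
    pd_mul (dθ i) (dθ j)]
  simp only [Fin.sum_univ_two, cov, hq _ _ hy] at *
  linear_combination - Q y * C.theta j y * H1 - Q y * C.theta i y * H2

end PlaneConformal

/-! ### The Laplacian and the Bochner formula -/

/-- The positive Laplacian of a metric on the plane. -/
def planeLaplacian (G : Plane → Matrix (Fin 2) (Fin 2) ℝ) (f : Plane → ℝ) (y : Plane) : ℝ :=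
  - (1 / Real.sqrt (G y).det) *
    ∑ i, pd i (fun z => Real.sqrt (G z).det * ∑ j, (G z)⁻¹ i j * pd j f z) y

namespace PlaneConformal

variable {C : PlaneConformal} {y : Plane} {G : Plane → Matrix (Fin 2) (Fin 2) ℝ}

variable (C) in
/-- The components `V₀, V₁` of the gradient of `f`, multiplied by `λ m`. They are characterized by
`df ∘ J = V₁ dx - V₀ dy`. -/
def flux (f : Plane → ℝ) : Fin 2 → Plane → ℝ :=
  ![fun z => ((C.p z ^ 2 + C.m z ^ 2) * pd 0 f z - C.p z * pd 1 f z) / C.m z,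
    fun z => (-C.p z * pd 0 f z + pd 1 f z) / C.m z]

variable (C) in
/-- The divergence `∂₀ V₀ + ∂₁ V₁` of the flux of `f`, so that
`d(df ∘ J) = -divFlux f dx ∧ dy`. -/
def divFlux (f : Plane → ℝ) (y : Plane) : ℝ := pd 0 (C.flux f 0) y + pd 1 (C.flux f 1) y

lemma flux_zero (f : Plane → ℝ) : C.flux f 0 =
    fun z => ((C.p z ^ 2 + C.m z ^ 2) * pd 0 f z - C.p z * pd 1 f z) / C.m z := rfl

lemma flux_one (f : Plane → ℝ) : C.flux f 1 =
    fun z => (-C.p z * pd 0 f z + pd 1 f z) / C.m z := rfl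

lemma divFlux_congr {f g : Plane → ℝ} (h : Set.EqOn f g C.U) (hy : y ∈ C.U) :
    C.divFlux f y = C.divFlux g y := by
  have e : ∀ i, Set.EqOn (C.flux f i) (C.flux g i) C.U := by
    intro i z hz
    have hp := fun j => pd_congr (i := j) C.isOpen hz h
    revert i
    simp only [Fin.forall_fin_two, flux_zero, flux_one, hp, and_self]
  rw [divFlux, divFlux, pd_congr C.isOpen hy (e 0), pd_congr C.isOpen hy (e 1)]

lemma flux_smooth {f : Plane → ℝ} (hf : ContDiffOn ℝ ∞ f C.U) (i : Fin 2) :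
    ContDiffOn ℝ ∞ (C.flux f i) C.U := by
  have h0 := hf.pd C.isOpen 0
  have h1 := hf.pd C.isOpen 1
  fin_cases i
  · exact (((((C.p_smooth.pow 2).add (C.m_smooth.pow 2)).mul h0).sub
      (C.p_smooth.mul h1))).div C.m_smooth C.m_ne
  · exact ((C.p_smooth.neg.mul h0).add h1).div C.m_smooth C.m_ne

lemma laplacian_eq (hG : Set.EqOn G C.gram C.U) {f : Plane → ℝ} (hf : ContDiffOn ℝ ∞ f C.U)
    (hy : y ∈ C.U) : planeLaplacian G f y = - C.divFlux f y / (C.lam y * C.m y) := by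
  have hl := C.lam_pos y hy
  have hm := C.m_ne y hy
  have hdet : ∀ z ∈ C.U, Real.sqrt (G z).det = C.lam z * |C.m z| := by
    intro z hz
    rw [hG hz, det_gram, ← mul_pow, Real.sqrt_sq_eq_abs, abs_mul, abs_of_pos (C.lam_pos z hz)]
  -- the sign of `m` is locally constant
  have hs : ∀ᶠ z in nhds y, |C.m z| / C.m z = |C.m y| / C.m y := by
    have hc : ContinuousAt C.m y :=
      (C.m_smooth.differentiableAt_of_isOpen C.isOpen hy).continuousAt
    rcases lt_or_gt_of_ne hm with h | h
    · filter_upwards [hc.eventually_lt_const h] with z hz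
      rw [abs_of_neg hz, abs_of_neg h, neg_div, neg_div, div_self hz.ne, div_self h.ne]
    · filter_upwards [hc.eventually_const_lt h] with z hz
      rw [abs_of_pos hz, abs_of_pos h, div_self hz.ne', div_self h.ne']
  have key : ∀ i, pd i (fun z => Real.sqrt (G z).det * ∑ j, (G z)⁻¹ i j * pd j f z) y
      = |C.m y| / C.m y * pd i (C.flux f i) y := by
    intro i
    rw [← pd_const_mul _ ((flux_smooth hf i).differentiableAt_of_isOpen C.isOpen hy)]
    unfold pd
    congr 1
    apply Filter.EventuallyEq.fderiv_eq
    filter_upwards [hs, C.isOpen.mem_nhds hy] with z hz hzU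
    have hlz := lam_ne hzU
    have hmz := C.m_ne z hzU
    rw [← hz, hdet z hzU, hG hzU, inv_gram hzU]
    revert i
    simp only [Fin.forall_fin_two, Fin.sum_univ_two, flux_zero, flux_one, Matrix.of_apply,
      Matrix.cons_val', Matrix.cons_val_zero, Matrix.cons_val_one, Matrix.cons_val_fin_one]
    constructor
    · unfold pd
      field_simp
      ring
    · unfold pd
      field_simp
  have ha := abs_ne_zero.2 hm
  have hl' := hl.ne'
  rw [planeLaplacian, Fin.sum_univ_two, key, key, hdet y hy, divFlux]
  field_simp

lemma flux_comp {s : Plane → ℝ} (hs : ContDiffOn ℝ ∞ s C.U) {I : Set ℝ}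
    (hI : Set.MapsTo s C.U I) {φ φ' : ℝ → ℝ} (h1 : ∀ t ∈ I, HasDerivAt φ (φ' t) t)
    (hy : y ∈ C.U) (i : Fin 2) :
    C.flux (fun z => φ (s z)) i y = φ' (s y) * C.flux s i y := by
  have hp := fun j => pd_comp (i := j) (h1 _ (hI hy)) (hs.differentiableAt_of_isOpen C.isOpen hy)
  revert i
  simp only [Fin.forall_fin_two, flux_zero, flux_one, hp]
  constructor <;> ring

/-- The chain rule `Δ(φ ∘ s) = φ' Δs - φ'' |ds|²`, in terms of `divFlux`. -/
lemma divFlux_comp {s : Plane → ℝ} (hs : ContDiffOn ℝ ∞ s C.U) {I : Set ℝ}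
    (hI : Set.MapsTo s C.U I) {φ φ' φ'' : ℝ → ℝ} (h1 : ∀ t ∈ I, HasDerivAt φ (φ' t) t)
    (h2 : ∀ t ∈ I, HasDerivAt φ' (φ'' t) t) (hy : y ∈ C.U) :
    C.divFlux (fun z => φ (s z)) y = φ' (s y) * C.divFlux s y
      + φ'' (s y) * (C.flux s 0 y * pd 0 s y + C.flux s 1 y * pd 1 s y) := by
  have ds := hs.differentiableAt_of_isOpen C.isOpen hy
  have hd := h2 _ (hI hy)
  have dφ : DifferentiableAt ℝ (fun z => φ' (s z)) y := hd.differentiableAt.comp y ds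
  have dV := fun j => (flux_smooth hs j).differentiableAt_of_isOpen C.isOpen hy
  have e := fun i j => pd_congr (i := i) C.isOpen hy fun z hz => flux_comp hs hI h1 hz j
  rw [divFlux, e, e, pd_mul dφ (dV 0), pd_mul dφ (dV 1), pd_comp hd ds, pd_comp hd ds, divFlux]
  ring

section Holomorphic

variable {Q : Plane → ℂ}

lemma cov_smooth (hQ : ContDiffOn ℝ ∞ Q C.U) (k : Fin 2) : ContDiffOn ℝ ∞ (C.cov Q k) C.U :=
  (hQ.pd C.isOpen k).sub ((contDiffOn_const.mul (eta_smooth k)).mul hQ)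

variable (C Q) in
/-- The squared norm `|σ|²` of `σ = Q θ²`. -/
def normSq (y : Plane) : ℝ := Complex.normSq (Q y) / C.lam y ^ 2

variable (C Q) in
/-- The coefficient `h` of the `(1,0)`-part `h θ` of `d|σ|²`, for holomorphic `σ = Q θ²`. -/
def dNormSq (y : Plane) : ℂ :=
  (starRingEnd ℂ) (Q y) * C.cov Q 0 y / (C.lam y : ℂ) ^ 2

lemma contDiffOn_conj {f : Plane → ℂ} {U : Set Plane} (hf : ContDiffOn ℝ ∞ f U) :
    ContDiffOn ℝ ∞ (fun y => (starRingEnd ℂ) (f y)) U :=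
  Complex.conjCLE.contDiff.comp_contDiffOn hf

lemma normSq_smooth (hQ : ContDiffOn ℝ ∞ Q C.U) : ContDiffOn ℝ ∞ (C.normSq Q) C.U := by
  have h : ContDiffOn ℝ ∞ (fun z => Complex.normSq (Q z)) C.U :=
    (((contDiffOn_re hQ).mul (contDiffOn_re hQ)).add
      ((contDiffOn_im hQ).mul (contDiffOn_im hQ)))
  exact h.div (C.lam_smooth.pow 2) fun z hz => pow_ne_zero 2 (lam_ne hz)

lemma dNormSq_smooth (hQ : ContDiffOn ℝ ∞ Q C.U) : ContDiffOn ℝ ∞ (C.dNormSq Q) C.U := by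
  have h : ContDiffOn ℝ ∞ (fun z => (C.lam z ^ 2)⁻¹) C.U :=
    (C.lam_smooth.pow 2).inv fun z hz => pow_ne_zero 2 (lam_ne hz)
  refine (((contDiffOn_conj hQ).mul (cov_smooth hQ 0)).mul (contDiffOn_ofReal h)).congr
    fun z _ => ?_
  simp [dNormSq, div_eq_mul_inv]

lemma pd_normSq (hQ : ContDiffOn ℝ ∞ Q C.U) (hy : y ∈ C.U) (i : Fin 2) :
    pd i (C.normSq Q) y
      = 2 * ((starRingEnd ℂ) (Q y) * C.cov Q i y).re / C.lam y ^ 2 := by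
  have hl := lam_ne hy
  have dl := C.lam_smooth.differentiableAt_of_isOpen C.isOpen hy
  have dQ := hQ.differentiableAt_of_isOpen C.isOpen hy
  have dr := (contDiffOn_re hQ).differentiableAt_of_isOpen C.isOpen hy
  have di := (contDiffOn_im hQ).differentiableAt_of_isOpen C.isOpen hy
  have dS := (normSq_smooth hQ).differentiableAt_of_isOpen C.isOpen hy
  have e : Set.EqOn (fun z => C.normSq Q z * (C.lam z * C.lam z))
      (fun z => (Q z).re * (Q z).re + (Q z).im * (Q z).im) C.U := by
    intro z hz
    have hlz := lam_ne hz
    simp only [normSq, Complex.normSq_apply]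
    field_simp
  have h := pd_congr (i := i) C.isOpen hy e
  rw [pd_mul dS (dl.fun_mul dl), pd_mul dl dl, pd_add (dr.fun_mul dr) (di.fun_mul di),
    pd_mul dr dr, pd_mul di di, pd_re dQ, pd_im dQ] at h
  have hη := eta_re (C := C) (y := y) i
  have e' : C.normSq Q y = ((Q y).re * (Q y).re + (Q y).im * (Q y).im) / C.lam y ^ 2 := rfl
  rw [e'] at h
  simp only [cov, Complex.mul_re, Complex.mul_im, Complex.sub_re, Complex.sub_im, Complex.conj_re,
    Complex.conj_im, Complex.re_ofNat, Complex.im_ofNat, hη]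
  field_simp at h ⊢
  linear_combination h

variable (hQ : ContDiffOn ℝ ∞ Q C.U) (hol : ∀ z ∈ C.U, C.cov Q 1 z = C.mu z * C.cov Q 0 z)
include hQ hol

lemma pd_normSq_eq (hy : y ∈ C.U) :
    pd 0 (C.normSq Q) y = 2 * (C.dNormSq Q y).re ∧
    pd 1 (C.normSq Q) y = 2 * (C.mu y * C.dNormSq Q y).re := by
  have hc : ((C.lam y : ℂ) ^ 2) = ((C.lam y ^ 2 : ℝ) : ℂ) := by push_cast; rfl
  constructor
  · rw [pd_normSq hQ hy, dNormSq, hc, Complex.div_ofReal_re]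
    ring
  · rw [pd_normSq hQ hy, dNormSq, hc, hol y hy, ← mul_div_assoc, Complex.div_ofReal_re,
      mul_left_comm]
    ring

lemma flux_normSq (hy : y ∈ C.U) :
    C.flux (C.normSq Q) 0 y = 2 * (C.mu y * C.dNormSq Q y).im ∧
    C.flux (C.normSq Q) 1 y = - 2 * (C.dNormSq Q y).im := by
  have hm := C.m_ne y hy
  obtain ⟨h0, h1⟩ := pd_normSq_eq hQ hol hy
  simp only [flux_zero, flux_one, h0, h1, Complex.mul_re, Complex.mul_im, mu_re, mu_im]
  constructor <;> field_simp <;> ring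

/-- The identity `|d|σ|²|² = 4 |σ|² |∂σ|²` for holomorphic quadratic differentials, in terms of
the flux. -/
lemma flux_normSq_dot (hy : y ∈ C.U) :
    C.flux (C.normSq Q) 0 y * pd 0 (C.normSq Q) y
      + C.flux (C.normSq Q) 1 y * pd 1 (C.normSq Q) y
      = 4 * C.m y * C.normSq Q y * Complex.normSq (C.cov Q 0 y) / C.lam y ^ 2 := by
  obtain ⟨h0, h1⟩ := pd_normSq_eq hQ hol hy
  obtain ⟨h2, h3⟩ := flux_normSq hQ hol hy
  have e : Complex.normSq (C.dNormSq Q y)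
      = C.normSq Q y * Complex.normSq (C.cov Q 0 y) / C.lam y ^ 2 := by
    have hl := lam_ne hy
    simp only [dNormSq, normSq, map_mul, map_div₀, map_pow, Complex.normSq_conj,
      Complex.normSq_ofReal]
    field_simp
  rw [h0, h1, h2, h3, mul_assoc (4 * C.m y), mul_div_assoc, ← e, Complex.normSq_apply]
  simp only [Complex.mul_re, Complex.mul_im, mu_re, mu_im]
  ring

/-- The Bochner formula `Δ|σ|² = -4 |∂σ|² - 4 K |σ|²` for holomorphic quadratic differentials, in
terms of `divFlux`, with `|∂σ|² = |N₀|² / λ³`. -/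
lemma divFlux_normSq (hy : y ∈ C.U) :
    C.divFlux (C.normSq Q) y
      = 4 * (C.m y * Complex.normSq (C.cov Q 0 y) - C.curv y * Complex.normSq (Q y))
        / C.lam y ^ 2 := by
  have hl := lam_ne hy
  have hlC : (C.lam y : ℂ) ≠ 0 := by exact_mod_cast hl
  have dl := (contDiffOn_ofReal C.lam_smooth).differentiableAt_of_isOpen C.isOpen hy
  have dl' := C.lam_smooth.differentiableAt_of_isOpen C.isOpen hy
  have dQ := hQ.differentiableAt_of_isOpen C.isOpen hy
  have dQ' := (contDiffOn_conj hQ).differentiableAt_of_isOpen C.isOpen hy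
  have dpQ := fun j => (hQ.pd C.isOpen j).differentiableAt_of_isOpen C.isOpen hy
  have dη := fun j => (eta_smooth (C := C) j).differentiableAt_of_isOpen C.isOpen hy
  have dN := fun j => (cov_smooth hQ j).differentiableAt_of_isOpen C.isOpen hy
  have dh := (dNormSq_smooth hQ).differentiableAt_of_isOpen C.isOpen hy
  have dμ := (mu_smooth (C := C)).differentiableAt_of_isOpen C.isOpen hy
  have e0 := pd_congr (i := 0) C.isOpen hy fun z hz => (flux_normSq hQ hol hz).1
  have e1 := pd_congr (i := 1) C.isOpen hy fun z hz => (flux_normSq hQ hol hz).2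
  have dμh : DifferentiableAt ℝ (fun z => C.mu z * C.dNormSq Q z) y := dμ.fun_mul dh
  have dim1 : DifferentiableAt ℝ (fun z => (C.mu z * C.dNormSq Q z).im) y :=
    Complex.imCLM.differentiableAt.comp y dμh
  have dim2 : DifferentiableAt ℝ (fun z => (C.dNormSq Q z).im) y :=
    Complex.imCLM.differentiableAt.comp y dh
  rw [pd_const_mul _ dim1, pd_im dμh, pd_mul dμ dh] at e0
  rw [pd_const_mul _ dim2, pd_im dh] at e1
  -- the ingredients of the integrability condition `dN = 2η ∧ N - 2Q dη`
  have hN : ∀ i j, pd i (C.cov Q j) y = pd i (pd j Q) y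
      - (2 * pd i (C.eta j) y * Q y + 2 * C.eta j y * pd i Q y) := by
    intro i j
    have d2 : DifferentiableAt ℝ (fun z => 2 * C.eta j z) y := (dη j).const_mul 2
    have : pd i (C.cov Q j) y = pd i (fun z => pd j Q z - 2 * C.eta j z * Q z) y := rfl
    rw [this, pd_sub (dpQ j) (d2.fun_mul dQ), pd_mul d2 dQ, pd_const_mul _ (dη j)]
  have hS := pd_comm hQ C.isOpen hy 0 1
  have hN1 := pd_congr (i := 0) C.isOpen hy hol
  rw [pd_mul dμ (dN 0), hN 0 1] at hN1
  have hN0 := hN 1 0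
  have hκ := curv_eq hy
  -- the derivatives of `λ² h = conj Q * N₀`
  have hH : ∀ i, pd i (C.dNormSq Q) y * (C.lam y : ℂ) ^ 2
      + C.dNormSq Q y * (2 * C.lam y * ((pd i C.lam y : ℝ) : ℂ))
      = (starRingEnd ℂ) (pd i Q y) * C.cov Q 0 y
        + (starRingEnd ℂ) (Q y) * pd i (C.cov Q 0) y := by
    intro i
    have e : Set.EqOn (fun z => C.dNormSq Q z * ((C.lam z : ℂ) * (C.lam z : ℂ)))
        (fun z => (starRingEnd ℂ) (Q z) * C.cov Q 0 z) C.U := by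
      intro z hz
      have hlz : (C.lam z : ℂ) ≠ 0 := by exact_mod_cast lam_ne hz
      simp only [dNormSq]
      field_simp
    have := pd_congr (i := i) C.isOpen hy e
    rw [pd_mul dh (dl.fun_mul dl), pd_mul dl dl, pd_mul dQ' (dN 0), pd_conj dQ,
      pd_ofReal dl'] at this
    rw [← this]
    ring
  have hh : C.dNormSq Q y * (C.lam y : ℂ) ^ 2 = (starRingEnd ℂ) (Q y) * C.cov Q 0 y := by
    simp only [dNormSq]
    field_simp
  -- metric compatibility `η + conj η = d (log λ)`
  have hη : ∀ i, ((pd i C.lam y : ℝ) : ℂ)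
      = C.lam y * (C.eta i y + (starRingEnd ℂ) (C.eta i y)) := by
    intro i
    rw [Complex.add_conj, eta_re]
    push_cast
    field_simp
  have c0 : (starRingEnd ℂ) (pd 0 Q y) = (starRingEnd ℂ) (C.cov Q 0 y)
      + 2 * (starRingEnd ℂ) (C.eta 0 y) * (starRingEnd ℂ) (Q y) := by
    simp only [cov, map_sub, map_mul, Complex.conj_ofNat]
    ring
  have c1 : (starRingEnd ℂ) (pd 1 Q y) = (starRingEnd ℂ) (C.mu y * C.cov Q 0 y)
      + 2 * (starRingEnd ℂ) (C.eta 1 y) * (starRingEnd ℂ) (Q y) := by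
    rw [← hol y hy]
    simp only [cov, map_sub, map_mul, Complex.conj_ofNat]
    ring
  have q0 : pd 0 Q y = C.cov Q 0 y + 2 * C.eta 0 y * Q y := by simp [cov]
  have q1 : pd 1 Q y = C.mu y * C.cov Q 0 y + 2 * C.eta 1 y * Q y := by
    rw [← hol y hy]
    simp [cov]
  have hμ : C.mu y - (starRingEnd ℂ) (C.mu y) = 2 * C.m y * Complex.I := by
    rw [Complex.sub_conj, mu_im]
    push_cast
    ring
  have n1 : (Complex.normSq (C.cov Q 0 y) : ℂ)
      = (starRingEnd ℂ) (C.cov Q 0 y) * C.cov Q 0 y := Complex.normSq_eq_conj_mul_self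
  have n2 : (Complex.normSq (Q y) : ℂ) = (starRingEnd ℂ) (Q y) * Q y :=
    Complex.normSq_eq_conj_mul_self
  have H0 := hH 0
  have H1 := hH 1
  rw [hη, c0] at H0
  rw [hη, c1, map_mul] at H1
  rw [q0] at hN1
  rw [q1] at hN0
  -- the coefficient of `d(hθ)`, multiplied by `λ²`
  have key : (pd 0 C.mu y * C.dNormSq Q y + C.mu y * pd 0 (C.dNormSq Q) y
      - pd 1 (C.dNormSq Q) y) * (C.lam y : ℂ) ^ 2
      = ((2 * (C.m y * Complex.normSq (C.cov Q 0 y)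
        - C.curv y * Complex.normSq (Q y)) : ℝ) : ℂ) * Complex.I := by
    push_cast
    rw [n1, n2]
    linear_combination pd 0 C.mu y * hh + C.mu y * H0 - H1
      - 2 * (C.mu y * (C.eta 0 y + (starRingEnd ℂ) (C.eta 0 y))
        - (C.eta 1 y + (starRingEnd ℂ) (C.eta 1 y))) * hh
      - (starRingEnd ℂ) (Q y) * hN1 - (starRingEnd ℂ) (Q y) * hN0
      + (starRingEnd ℂ) (Q y) * hS - 2 * (starRingEnd ℂ) (Q y) * Q y * hκ
      + (starRingEnd ℂ) (C.cov Q 0 y) * C.cov Q 0 y * hμ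
  have key' := congrArg Complex.im key
  rw [show (C.lam y : ℂ) ^ 2 = ((C.lam y ^ 2 : ℝ) : ℂ) by push_cast; rfl, Complex.im_mul_ofReal,
    Complex.im_ofReal_mul, Complex.I_im, mul_one] at key'
  rw [divFlux, e0, e1, eq_div_iff (pow_ne_zero 2 hl)]
  rw [Complex.sub_im] at key'
  linear_combination 2 * key'

end Holomorphic

end PlaneConformal

/-! ### The moment map identity in the plane -/

namespace PlaneConformal

variable {C : PlaneConformal} {y : Plane} {Q : Plane → ℂ}

lemma hasDerivAt_sqrt_one_sub {t : ℝ} (ht : t < 1) :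
    HasDerivAt (fun t => Real.sqrt (1 - t)) (-1 / (2 * Real.sqrt (1 - t))) t :=
  ((hasDerivAt_id t).const_sub 1).sqrt (sub_pos.2 ht).ne'

lemma hasDerivAt_log_one_add_sqrt {t : ℝ} (ht : t < 1) :
    HasDerivAt (fun t => Real.log (1 + Real.sqrt (1 - t)))
      (-1 / (2 * Real.sqrt (1 - t)) / (1 + Real.sqrt (1 - t))) t :=
  ((hasDerivAt_sqrt_one_sub ht).const_add 1).log
    (add_pos_of_pos_of_nonneg one_pos (Real.sqrt_nonneg _)).ne'

lemma hasDerivAt_deriv_sqrt_one_sub {t : ℝ} (ht : t < 1) :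
    HasDerivAt (fun t => -1 / (2 * Real.sqrt (1 - t))) (-1 / (4 * Real.sqrt (1 - t) ^ 3)) t := by
  have hw : 0 < Real.sqrt (1 - t) := Real.sqrt_pos.2 (sub_pos.2 ht)
  refine ((hasDerivAt_const t (-1 : ℝ)).fun_div ((hasDerivAt_sqrt_one_sub ht).const_mul 2)
    (by positivity)).congr_deriv ?_
  field_simp
  ring

lemma hasDerivAt_deriv_log_one_add_sqrt {t : ℝ} (ht : t < 1) :
    HasDerivAt (fun t => -1 / (2 * Real.sqrt (1 - t)) / (1 + Real.sqrt (1 - t)))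
      (-(1 + 2 * Real.sqrt (1 - t)) / (4 * Real.sqrt (1 - t) ^ 3 * (1 + Real.sqrt (1 - t)) ^ 2))
      t := by
  have hw : 0 < Real.sqrt (1 - t) := Real.sqrt_pos.2 (sub_pos.2 ht)
  refine ((hasDerivAt_deriv_sqrt_one_sub ht).fun_div ((hasDerivAt_sqrt_one_sub ht).const_add 1)
    (by positivity)).congr_deriv ?_
  field_simp
  ring

/-- The moment map identity in the plane, with the Gaussian curvature `K` written as
`-k / (λ m)` and the Laplacian of `f` as `-divFlux f / (λ m)`. -/
lemma momentMap_eq (hQ : ContDiffOn ℝ ∞ Q C.U)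
    (hol : ∀ z ∈ C.U, C.cov Q 1 z = C.mu z * C.cov Q 0 z) (h1 : ∀ z ∈ C.U, C.normSq Q z < 1)
    (hy : y ∈ C.U) :
    Complex.normSq (C.cov Q 0 y) / C.lam y ^ 3 / Real.sqrt (1 - C.normSq Q y)
      - 2 * Real.sqrt (1 - C.normSq Q y) * (- C.curv y / (C.lam y * C.m y))
      + C.divFlux (fun z => Real.sqrt (1 - C.normSq Q z)) y / (C.lam y * C.m y)
    = -(2 * (- C.curv y / (C.lam y * C.m y))
      + - C.divFlux (fun z => Real.log (1 + Real.sqrt (1 - C.normSq Q z))) y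
        / (C.lam y * C.m y)) := by
  have hl := lam_ne hy
  have hm := C.m_ne y hy
  have hs := normSq_smooth hQ
  rw [divFlux_comp (I := Set.Iio 1) hs h1 (fun t ht => hasDerivAt_sqrt_one_sub ht)
      (fun t ht => hasDerivAt_deriv_sqrt_one_sub ht) hy,
    divFlux_comp (I := Set.Iio 1) hs h1 (fun t ht => hasDerivAt_log_one_add_sqrt ht)
      (fun t ht => hasDerivAt_deriv_log_one_add_sqrt ht) hy,
    flux_normSq_dot hQ hol hy, divFlux_normSq hQ hol hy]
  have hw : 0 < Real.sqrt (1 - C.normSq Q y) := Real.sqrt_pos.2 (sub_pos.2 (h1 y hy))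
  have hsq : Real.sqrt (1 - C.normSq Q y) ^ 2 = 1 - C.normSq Q y :=
    Real.sq_sqrt (sub_pos.2 (h1 y hy)).le
  have hn : Complex.normSq (Q y) = C.normSq Q y * C.lam y ^ 2 := by
    rw [normSq]
    field_simp
  -- everything is expressed through `w = √(1 - |σ|²)`, by `|σ|² = 1 - w²`
  rw [hn, show C.normSq Q y = 1 - Real.sqrt (1 - C.normSq Q y) ^ 2 by rw [hsq]; ring]
  rw [sub_sub_cancel, Real.sqrt_sq hw.le]
  generalize Real.sqrt (1 - C.normSq Q y) = w at *
  have hw1 : 1 + w ≠ 0 := by positivity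
  field_simp
  ring

end PlaneConformal

/-! ### Charts and the complex structure in coordinates -/

section Manifold

variable {S : Type*} [TopologicalSpace S] [ChartedSpace Plane S]
  {x₀ x : S} {y : Plane}

lemma isOpen_target (x₀ : S) : IsOpen (extChartAt (𝓡 2) x₀).target := isOpen_extChartAt_target x₀

lemma chartInv_mem (hy : y ∈ (extChartAt (𝓡 2) x₀).target) :
    chartInv x₀ y ∈ (extChartAt (𝓡 2) x₀).source := (extChartAt (𝓡 2) x₀).map_target hy

lemma extChartAt_chartInv (hy : y ∈ (extChartAt (𝓡 2) x₀).target) :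
    extChartAt (𝓡 2) x₀ (chartInv x₀ y) = y := (extChartAt (𝓡 2) x₀).right_inv hy

lemma exists_eq_chartInv (hx : x ∈ (extChartAt (𝓡 2) x₀).source) :
    ∃ y ∈ (extChartAt (𝓡 2) x₀).target, x = chartInv x₀ y :=
  ⟨_, (extChartAt (𝓡 2) x₀).map_source hx, ((extChartAt (𝓡 2) x₀).left_inv hx).symm⟩

variable [IsManifold (𝓡 2) ∞ S]

lemma mdifferentiableAt_chartInv (hy : y ∈ (extChartAt (𝓡 2) x₀).target) :
    MDifferentiableAt (𝓡 2) (𝓡 2) (chartInv x₀) y := by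
  have h := mdifferentiableWithinAt_extChartAt_symm (I := 𝓡 2) hy
  simp only [modelWithCornersSelf_coe, Set.range_id, mdifferentiableWithinAt_univ] at h
  exact h

lemma mdifferentiableAt_chart (hx : x ∈ (extChartAt (𝓡 2) x₀).source) :
    MDifferentiableAt (𝓡 2) (𝓡 2) (extChartAt (𝓡 2) x₀) x :=
  mdifferentiableAt_extChartAt (by simpa using hx)

lemma comp_coordVec (hy : y ∈ (extChartAt (𝓡 2) x₀).target) (i k : Fin 2) :
    comp x₀ (chartInv x₀ y) (coordVec x₀ y i) k = if k = i then 1 else 0 := by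
  have h := mfderiv_extChartAt_comp_mfderivWithin_extChartAt_symm (I := 𝓡 2) hy
  simp only [modelWithCornersSelf_coe, Set.range_id, mfderivWithin_univ] at h
  have h' := congrArg (fun L => L (EuclideanSpace.single i (1 : ℝ) : Plane)) h
  have : comp x₀ (chartInv x₀ y) (coordVec x₀ y i) k
    = (EuclideanSpace.single i (1 : ℝ) : Plane) k := congrArg (fun w : Plane => w k) h'
  rw [this]
  simp

/-- The coordinate vectors span the tangent space, with coefficients given by `comp`. -/
lemma comp_eq_sum (hy : y ∈ (extChartAt (𝓡 2) x₀).target) (v : Tan (chartInv x₀ y)) :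
    v = comp x₀ (chartInv x₀ y) v 0 • coordVec x₀ y 0
      + comp x₀ (chartInv x₀ y) v 1 • coordVec x₀ y 1 := by
  have h := mfderivWithin_extChartAt_symm_comp_mfderiv_extChartAt (I := 𝓡 2) hy
  simp only [modelWithCornersSelf_coe, Set.range_id, mfderivWithin_univ] at h
  have h' : mfderiv (𝓡 2) (𝓡 2) (chartInv x₀) y
      (mfderiv (𝓡 2) (𝓡 2) (extChartAt (𝓡 2) x₀) (chartInv x₀ y) v) = v :=
    congrArg (fun L => L v) h
  have hw : ∀ w : Plane, w = w 0 • (EuclideanSpace.single 0 (1 : ℝ) : Plane)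
      + w 1 • (EuclideanSpace.single 1 (1 : ℝ) : Plane) := by
    intro w
    ext i
    fin_cases i <;> simp
  conv_lhs => rw [← h', hw (mfderiv (𝓡 2) (𝓡 2) (extChartAt (𝓡 2) x₀) (chartInv x₀ y) v)]
  exact (ContinuousLinearMap.map_add _ _ _).trans
    (congrArg₂ _ (ContinuousLinearMap.map_smul _ _ _) (ContinuousLinearMap.map_smul _ _ _))

end Manifold

section ConformalChart

variable {S : Type*} [TopologicalSpace S] [ChartedSpace Plane S] {ρ : AreaForm S}
  (J : ComplexStructure ρ) {x₀ x : S} {y : Plane}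

lemma comp_add (u v : Tan x) (i : Fin 2) :
    comp x₀ x (u + v) i = comp x₀ x u i + comp x₀ x v i :=
  congrArg (fun w : Plane => w i)
    ((mfderiv (𝓡 2) (𝓡 2) (extChartAt (𝓡 2) x₀) x).map_add u v)

lemma comp_smul (c : ℝ) (v : Tan x) (i : Fin 2) :
    comp x₀ x (c • v) i = c * comp x₀ x v i :=
  congrArg (fun w : Plane => w i)
    ((mfderiv (𝓡 2) (𝓡 2) (extChartAt (𝓡 2) x₀) x).map_smul c v)

lemma comp_neg (v : Tan x) (i : Fin 2) : comp x₀ x (-v) i = - comp x₀ x v i := by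
  rw [← neg_one_smul ℝ v, comp_smul]
  ring

lemma diff_add_smul (f : S → ℝ) (a b : ℝ) (u v : Tan x) :
    diff f x (a • u + b • v) = a * diff f x u + b * diff f x v := by
  unfold diff
  rw [ContinuousLinearMap.map_add, ContinuousLinearMap.map_smul, ContinuousLinearMap.map_smul]
  rfl

lemma AreaForm.form_swap (ρ : AreaForm S) (u v : Tan x) : ρ.form x v u = - ρ.form x u v := by
  have h := ρ.alt x (u + v)
  simp only [map_add, add_apply, ρ.alt] at h
  linarith

/-- The density `ρ(∂₀, ∂₁)` of the area form in a chart. -/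
def AreaForm.density (ρ : AreaForm S) (x₀ : S) (y : Plane) : ℝ :=
  ρ.form (chartInv x₀ y) (coordVec x₀ y 0) (coordVec x₀ y 1)

/-- The matrix of the complex structure in a chart: `J ∂_i = ∑ k, coeff k i ∂_k`. -/
def ComplexStructure.coeff (x₀ : S) (k i : Fin 2) (y : Plane) : ℝ :=
  comp x₀ (chartInv x₀ y) (J.J (chartInv x₀ y) (coordVec x₀ y i)) k

variable [IsManifold (𝓡 2) ∞ S]

lemma ComplexStructure.map_coordVec (hy : y ∈ (extChartAt (𝓡 2) x₀).target) (i : Fin 2) :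
    J.J (chartInv x₀ y) (coordVec x₀ y i)
      = J.coeff x₀ 0 i y • coordVec x₀ y 0 + J.coeff x₀ 1 i y • coordVec x₀ y 1 :=
  comp_eq_sum hy _

lemma ComplexStructure.coeff_relations (hy : y ∈ (extChartAt (𝓡 2) x₀).target) :
    J.coeff x₀ 1 0 y ≠ 0 ∧ J.coeff x₀ 1 1 y = - J.coeff x₀ 0 0 y ∧
    J.coeff x₀ 0 1 y = -(1 + J.coeff x₀ 0 0 y ^ 2) / J.coeff x₀ 1 0 y := by
  have h := J.sq (chartInv x₀ y) (coordVec x₀ y 0)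
  rw [J.map_coordVec hy, map_add, map_smul, map_smul, J.map_coordVec hy, J.map_coordVec hy] at h
  have h' := fun k => congrArg (fun v => comp x₀ (chartInv x₀ y) v k) h
  have h0 := h' 0
  have h1 := h' 1
  simp only [comp_add, comp_smul, comp_neg, comp_coordVec hy] at h0 h1
  norm_num at h0 h1
  have hc : J.coeff x₀ 1 0 y ≠ 0 := by
    intro hc
    rw [hc] at h0
    nlinarith [sq_nonneg (J.coeff x₀ 0 0 y)]
  refine ⟨hc, ?_, ?_⟩
  · apply mul_left_cancel₀ hc
    linarith
  · rw [eq_div_iff hc]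
    linarith

lemma ComplexStructure.form_map_coordVec (hy : y ∈ (extChartAt (𝓡 2) x₀).target) (i j : Fin 2) :
    ρ.form (chartInv x₀ y) (coordVec x₀ y i) (J.J (chartInv x₀ y) (coordVec x₀ y j))
      = J.coeff x₀ 0 j y * ρ.form (chartInv x₀ y) (coordVec x₀ y i) (coordVec x₀ y 0)
      + J.coeff x₀ 1 j y * ρ.form (chartInv x₀ y) (coordVec x₀ y i) (coordVec x₀ y 1) := by
  rw [J.map_coordVec hy, map_add, map_smul, map_smul, smul_eq_mul, smul_eq_mul]

lemma ComplexStructure.coeff_mul_density_pos (hy : y ∈ (extChartAt (𝓡 2) x₀).target) :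
    0 < J.coeff x₀ 1 0 y * ρ.density x₀ y := by
  have h0 : coordVec x₀ y 0 ≠ 0 := by
    intro h
    have h1 := comp_coordVec hy 0 0
    have h2 := comp_smul (x₀ := x₀) 0 (coordVec x₀ y 0) 0
    rw [zero_smul, ← h, h1] at h2
    norm_num at h2
  have h := J.pos (chartInv x₀ y) _ h0
  rw [J.form_map_coordVec hy, ρ.alt] at h
  simpa [AreaForm.density] using h

/-- The metric `ρ(·, J·)` in a chart, as `λ |dx + μ dy|²`, where `dx + μ dy` is the `(1,0)`-form
whose value on `∂₀` is `1`. -/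
def ComplexStructure.conformal (x₀ : S) : PlaneConformal where
  U := (extChartAt (𝓡 2) x₀).target
  isOpen := isOpen_target x₀
  lam := fun y => J.coeff x₀ 1 0 y * ρ.density x₀ y
  p := fun y => - J.coeff x₀ 0 0 y / J.coeff x₀ 1 0 y
  m := fun y => 1 / J.coeff x₀ 1 0 y
  lam_smooth := (J.smooth x₀ 0 1).mul (ρ.smooth x₀ 0 1)
  p_smooth := (J.smooth x₀ 0 0).neg.div (J.smooth x₀ 0 1) fun _ hy => (J.coeff_relations hy).1
  m_smooth := contDiffOn_const.div (J.smooth x₀ 0 1) fun _ hy => (J.coeff_relations hy).1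
  lam_pos := fun _ hy => J.coeff_mul_density_pos hy
  m_ne := fun _ hy => one_div_ne_zero (J.coeff_relations hy).1

lemma ComplexStructure.gram_eq (x₀ : S) :
    Set.EqOn (J.gram x₀) (J.conformal x₀).gram (J.conformal x₀).U := by
  intro y hy
  obtain ⟨hc, hd, hb⟩ := J.coeff_relations hy
  have hs : ρ.form (chartInv x₀ y) (coordVec x₀ y 1) (coordVec x₀ y 0) = - ρ.density x₀ y :=
    ρ.form_swap _ _
  have hd' : ρ.form (chartInv x₀ y) (coordVec x₀ y 0) (coordVec x₀ y 1) = ρ.density x₀ y := rfl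
  ext i j
  simp only [ComplexStructure.gram, ComplexStructure.metric, Matrix.of_apply,
    J.form_map_coordVec hy]
  revert i j
  simp only [Fin.forall_fin_two, ρ.alt, hs, hd', hd, hb, PlaneConformal.gram, Matrix.of_apply,
    Matrix.cons_val', Matrix.cons_val_zero, Matrix.cons_val_one, Matrix.cons_val_fin_one,
    ComplexStructure.conformal]
  refine ⟨⟨?_, ?_⟩, ?_, ?_⟩ <;> field_simp <;> ring

end ConformalChart

/-! ### Quadratic differentials in coordinates and their norms -/

section Pointwise

open PlaneConformal

variable {S : Type*} [TopologicalSpace S] [ChartedSpace Plane S] [IsManifold (𝓡 2) ∞ S]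
  {ρ : AreaForm S} (J : ComplexStructure ρ) {x₀ x : S} {y : Plane}

lemma ComplexStructure.lam_mul_m (hy : y ∈ (extChartAt (𝓡 2) x₀).target) :
    (J.conformal x₀).lam y * (J.conformal x₀).m y = ρ.density x₀ y := by
  have hc := (J.coeff_relations hy).1
  simp only [ComplexStructure.conformal]
  field_simp

lemma ComplexStructure.form_eq (hx : x ∈ (extChartAt (𝓡 2) x₀).source) (u v : Tan x) :
    ρ.form x u v = (J.conformal x₀).lam (extChartAt (𝓡 2) x₀ x)
      * (J.conformal x₀).m (extChartAt (𝓡 2) x₀ x)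
      * (comp x₀ x u 0 * comp x₀ x v 1 - comp x₀ x u 1 * comp x₀ x v 0) := by
  obtain ⟨y, hy, rfl⟩ := exists_eq_chartInv hx
  rw [extChartAt_chartInv hy, J.lam_mul_m hy]
  have hs : ρ.form (chartInv x₀ y) (coordVec x₀ y 1) (coordVec x₀ y 0) = - ρ.density x₀ y :=
    ρ.form_swap _ _
  have hd : ρ.form (chartInv x₀ y) (coordVec x₀ y 0) (coordVec x₀ y 1) = ρ.density x₀ y := rfl
  conv_lhs => rw [comp_eq_sum hy u, comp_eq_sum hy v]
  simp only [map_add, map_smul, add_apply, smul_apply, smul_eq_mul, ρ.alt, hs, hd]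
  ring

/-- The `(1,0)`-form `θ = dx + μ dy` of a chart, as a form on the surface. -/
def ComplexStructure.thetaForm (x₀ x : S) (v : Tan x) : ℂ :=
  comp x₀ x v 0 + (J.conformal x₀).mu (extChartAt (𝓡 2) x₀ x) * comp x₀ x v 1

lemma ComplexStructure.comp_map (hx : x ∈ (extChartAt (𝓡 2) x₀).source) (u : Tan x) (k : Fin 2) :
    comp x₀ x (J.J x u) k = J.coeff x₀ k 0 (extChartAt (𝓡 2) x₀ x) * comp x₀ x u 0
      + J.coeff x₀ k 1 (extChartAt (𝓡 2) x₀ x) * comp x₀ x u 1 := by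
  obtain ⟨y, hy, rfl⟩ := exists_eq_chartInv hx
  rw [extChartAt_chartInv hy]
  conv_lhs => rw [comp_eq_sum hy u]
  rw [map_add, map_smul, map_smul, comp_add, comp_smul, comp_smul, ComplexStructure.coeff,
    ComplexStructure.coeff]
  ring

lemma ComplexStructure.thetaForm_map (hx : x ∈ (extChartAt (𝓡 2) x₀).source) (u : Tan x) :
    J.thetaForm x₀ x (J.J x u) = Complex.I * J.thetaForm x₀ x u := by
  obtain ⟨hc, hd, hb⟩ := J.coeff_relations ((extChartAt (𝓡 2) x₀).map_source hx)
  rw [ComplexStructure.thetaForm, ComplexStructure.thetaForm, J.comp_map hx, J.comp_map hx, hd, hb]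
  apply Complex.ext <;>
  simp only [Complex.add_re, Complex.add_im, Complex.mul_re, Complex.mul_im, mu_re, mu_im,
    Complex.ofReal_re, Complex.ofReal_im, Complex.I_re, Complex.I_im] <;>
  simp only [ComplexStructure.conformal] <;> field_simp <;> ring

lemma ComplexStructure.metric_self (hx : x ∈ (extChartAt (𝓡 2) x₀).source) (v : Tan x) :
    J.metric x v v = (J.conformal x₀).lam (extChartAt (𝓡 2) x₀ x)
      * Complex.normSq (J.thetaForm x₀ x v) := by
  obtain ⟨hc, hd, hb⟩ := J.coeff_relations ((extChartAt (𝓡 2) x₀).map_source hx)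
  rw [ComplexStructure.metric, J.form_eq hx, J.comp_map hx, J.comp_map hx, hd, hb,
    ComplexStructure.thetaForm, Complex.normSq_apply]
  simp only [Complex.add_re, Complex.add_im, Complex.mul_re, Complex.mul_im, mu_re, mu_im,
    Complex.ofReal_re, Complex.ofReal_im]
  simp only [ComplexStructure.conformal]
  field_simp
  ring

lemma ComplexStructure.exists_unit (hx : x ∈ (extChartAt (𝓡 2) x₀).source) :
    ∃ v : Tan x, J.metric x v v = 1 := by
  have hl := (J.conformal x₀).lam_pos _ ((extChartAt (𝓡 2) x₀).map_source hx)
  obtain ⟨y, hy, rfl⟩ := exists_eq_chartInv hx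
  refine ⟨(1 / Real.sqrt ((J.conformal x₀).lam y)) • coordVec x₀ y 0, ?_⟩
  rw [J.metric_self hx, ComplexStructure.thetaForm, comp_smul, comp_smul, comp_coordVec hy,
    comp_coordVec hy]
  rw [extChartAt_chartInv hy] at *
  norm_num
  rw [← mul_inv, Real.mul_self_sqrt hl.le]
  exact mul_inv_cancel₀ hl.ne'

lemma ComplexStructure.norm_thetaForm_sq (hx : x ∈ (extChartAt (𝓡 2) x₀).source) {v : Tan x}
    (hv : J.metric x v v = 1) :
    ‖J.thetaForm x₀ x v‖ ^ 2 = ((J.conformal x₀).lam (extChartAt (𝓡 2) x₀ x))⁻¹ := by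
  rw [J.metric_self hx, Complex.normSq_eq_norm_sq] at hv
  exact eq_inv_of_mul_eq_one_right hv

variable {J} (σ : QuadraticDifferential J)

/-- The coefficient `Q` of `σ = Q θ²` in a chart. -/
def QuadraticDifferential.coeff (x₀ : S) (y : Plane) : ℂ :=
  σ.q (chartInv x₀ y) (coordVec x₀ y 0) (coordVec x₀ y 0)

lemma QuadraticDifferential.coeff_smooth (x₀ : S) :
    ContDiffOn ℝ ∞ (σ.coeff x₀) (J.conformal x₀).U := σ.smooth x₀ 0 0

lemma QuadraticDifferential.q_coordVec_one (hy : y ∈ (extChartAt (𝓡 2) x₀).target)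
    (v : Tan (chartInv x₀ y)) :
    σ.q (chartInv x₀ y) (coordVec x₀ y 1) v
      = (J.conformal x₀).mu y * σ.q (chartInv x₀ y) (coordVec x₀ y 0) v := by
  have hc := (J.coeff_relations hy).1
  have h := σ.map_J (chartInv x₀ y) (coordVec x₀ y 0) v
  rw [J.map_coordVec hy] at h
  simp only [map_add, map_smul, add_apply, smul_apply, Complex.real_smul] at h
  have hc' : (J.coeff x₀ 1 0 y : ℂ) ≠ 0 := by exact_mod_cast hc
  simp only [mu, ComplexStructure.conformal]
  push_cast
  field_simp
  linear_combination h

lemma QuadraticDifferential.q_coordVec (i j : Fin 2) :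
    Set.EqOn (fun z => σ.q (chartInv x₀ z) (coordVec x₀ z i) (coordVec x₀ z j))
      (fun z => σ.coeff x₀ z * ((J.conformal x₀).theta i z * (J.conformal x₀).theta j z))
      (J.conformal x₀).U := by
  intro z hz
  have h1 := σ.q_coordVec_one hz
  have h2 := σ.symm (chartInv x₀ z) (coordVec x₀ z 0) (coordVec x₀ z 1)
  revert i j
  simp only [Fin.forall_fin_two, theta_zero, theta_one, h1, h2, QuadraticDifferential.coeff]
  refine ⟨⟨?_, ?_⟩, ?_, ?_⟩ <;> ring

lemma QuadraticDifferential.q_self (hx : x ∈ (extChartAt (𝓡 2) x₀).source) (v : Tan x) :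
    σ.q x v v = σ.coeff x₀ (extChartAt (𝓡 2) x₀ x) * J.thetaForm x₀ x v ^ 2 := by
  obtain ⟨y, hy, rfl⟩ := exists_eq_chartInv hx
  have h := fun i j => σ.q_coordVec (x₀ := x₀) i j hy
  conv_lhs => rw [comp_eq_sum hy v]
  simp only [map_add, map_smul, add_apply, smul_apply, Complex.real_smul, h,
    ComplexStructure.thetaForm, extChartAt_chartInv hy, theta_zero, theta_one]
  ring

/-- The supremum of a set given by a predicate that holds for one number only. It evaluates the
pointwise norms, which are suprema over sets with a single element. -/
lemma csSup_const {p : ℝ → Prop} {c : ℝ} (h1 : ∀ r, p r → r = c) (h2 : p c) :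
    sSup {r | p r} = c := by
  have : {r | p r} = {c} := by
    ext r
    exact ⟨h1 r, fun h => by rw [Set.mem_singleton_iff.1 h]; exact h2⟩
  rw [this, csSup_singleton]

lemma QuadraticDifferential.norm_sq (hx : x ∈ (extChartAt (𝓡 2) x₀).source) :
    σ.norm x ^ 2 = (J.conformal x₀).normSq (σ.coeff x₀) (extChartAt (𝓡 2) x₀ x) := by
  have key : ∀ v : Tan x, J.metric x v v = 1 → ‖σ.q x v v‖
      = ‖σ.coeff x₀ (extChartAt (𝓡 2) x₀ x)‖
        * ((J.conformal x₀).lam (extChartAt (𝓡 2) x₀ x))⁻¹ := by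
    intro v hv
    rw [σ.q_self hx, norm_mul, norm_pow, J.norm_thetaForm_sq hx hv]
  obtain ⟨v, hv⟩ := J.exists_unit hx
  have : σ.norm x = ‖σ.coeff x₀ (extChartAt (𝓡 2) x₀ x)‖
        * ((J.conformal x₀).lam (extChartAt (𝓡 2) x₀ x))⁻¹ := by
    apply csSup_const
    · rintro r ⟨v, hv, rfl⟩
      exact key v hv
    · exact ⟨v, hv, (key v hv).symm⟩
  rw [this, PlaneConformal.normSq, Complex.normSq_eq_norm_sq]
  ring

lemma QuadraticDifferential.nablaComp_eq (hy : y ∈ (extChartAt (𝓡 2) x₀).target) (k i j : Fin 2) :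
    σ.nablaComp x₀ k i j y = (J.conformal x₀).cov (σ.coeff x₀) k y
      * ((J.conformal x₀).theta i y * (J.conformal x₀).theta j y) :=
  nabla_eq (J.gram_eq x₀) (σ.coeff_smooth x₀) (fun i j => σ.q_coordVec i j) hy k i j

lemma QuadraticDifferential.nabla_eq (hx : x ∈ (extChartAt (𝓡 2) x₀).source) (u v w : Tan x) :
    σ.nabla x₀ x u v w
      = (comp x₀ x u 0 * (J.conformal x₀).cov (σ.coeff x₀) 0 (extChartAt (𝓡 2) x₀ x)
        + comp x₀ x u 1 * (J.conformal x₀).cov (σ.coeff x₀) 1 (extChartAt (𝓡 2) x₀ x))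
        * (J.thetaForm x₀ x v * J.thetaForm x₀ x w) := by
  simp only [QuadraticDifferential.nabla, Fin.sum_univ_two,
    σ.nablaComp_eq ((extChartAt (𝓡 2) x₀).map_source hx), theta_zero, theta_one,
    ComplexStructure.thetaForm]
  push_cast
  ring

/-- In a chart, `∂̄σ = 0` says that `∇σ = N₀ θ ⊗ θ²`. -/
lemma QuadraticDifferential.cov_one (hσ : σ.IsHolomorphic)
    (hy : y ∈ (extChartAt (𝓡 2) x₀).target) :
    (J.conformal x₀).cov (σ.coeff x₀) 1 y
      = (J.conformal x₀).mu y * (J.conformal x₀).cov (σ.coeff x₀) 0 y := by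
  have hc := (J.coeff_relations hy).1
  have h := hσ x₀ _ (chartInv_mem hy) (coordVec x₀ y 0) (coordVec x₀ y 0) (coordVec x₀ y 0)
  have hθ : J.thetaForm x₀ (chartInv x₀ y) (coordVec x₀ y 0) = 1 := by
    simp [ComplexStructure.thetaForm, comp_coordVec hy]
  have hk : ∀ k, comp x₀ (chartInv x₀ y) (J.J (chartInv x₀ y) (coordVec x₀ y 0)) k
    = J.coeff x₀ k 0 y := fun _ => rfl
  rw [QuadraticDifferential.dbar, σ.nabla_eq (chartInv_mem hy), σ.nabla_eq (chartInv_mem hy), hθ,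
    extChartAt_chartInv hy, comp_coordVec hy, comp_coordVec hy, hk, hk] at h
  have hc' : (J.coeff x₀ 1 0 y : ℂ) ≠ 0 := by exact_mod_cast hc
  rw [show (J.conformal x₀).mu y
    = (-(J.coeff x₀ 0 0 y : ℂ) + Complex.I) / (J.coeff x₀ 1 0 y : ℂ) by
      simp only [mu, ComplexStructure.conformal]
      push_cast
      ring]
  rw [div_mul_eq_mul_div, eq_div_iff hc']
  norm_num at h
  have hI := Complex.I_mul_I
  linear_combination - Complex.I * h + ((J.conformal x₀).cov (σ.coeff x₀) 0 y * J.coeff x₀ 0 0 y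
    + (J.conformal x₀).cov (σ.coeff x₀) 1 y * J.coeff x₀ 1 0 y) * hI

lemma QuadraticDifferential.del_eq (hσ : σ.IsHolomorphic)
    (hx : x ∈ (extChartAt (𝓡 2) x₀).source) (u v w : Tan x) :
    σ.del x₀ x u v w = (J.conformal x₀).cov (σ.coeff x₀) 0 (extChartAt (𝓡 2) x₀ x)
      * J.thetaForm x₀ x u * (J.thetaForm x₀ x v * J.thetaForm x₀ x w) := by
  have h := J.thetaForm_map hx u
  rw [QuadraticDifferential.del, σ.nabla_eq hx, σ.nabla_eq hx,
    σ.cov_one hσ ((extChartAt (𝓡 2) x₀).map_source hx)]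
  simp only [ComplexStructure.thetaForm] at h ⊢
  have hI := Complex.I_mul_I
  generalize (J.conformal x₀).cov (σ.coeff x₀) 0 (extChartAt (𝓡 2) x₀ x) = N at *
  generalize (J.conformal x₀).mu (extChartAt (𝓡 2) x₀ x) = μ at *
  linear_combination (-(1 / 2) * Complex.I * N * (comp x₀ x v 0 + μ * comp x₀ x v 1)
    * (comp x₀ x w 0 + μ * comp x₀ x w 1)) * h
    - (1 / 2) * N * (comp x₀ x v 0 + μ * comp x₀ x v 1)
    * (comp x₀ x w 0 + μ * comp x₀ x w 1) * (comp x₀ x u 0 + μ * comp x₀ x u 1) * hI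

lemma QuadraticDifferential.formNorm_del_sq (hσ : σ.IsHolomorphic)
    (hx : x ∈ (extChartAt (𝓡 2) x₀).source) :
    formNorm J x (σ.del x₀ x) ^ 2
      = Complex.normSq ((J.conformal x₀).cov (σ.coeff x₀) 0 (extChartAt (𝓡 2) x₀ x))
        / (J.conformal x₀).lam (extChartAt (𝓡 2) x₀ x) ^ 3 := by
  have hl := (J.conformal x₀).lam_pos _ ((extChartAt (𝓡 2) x₀).map_source hx)
  have key : ∀ u v : Tan x, J.metric x u u = 1 → J.metric x v v = 1 → ‖σ.del x₀ x u v v‖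
      = Real.sqrt (Complex.normSq ((J.conformal x₀).cov (σ.coeff x₀) 0 (extChartAt (𝓡 2) x₀ x))
        / (J.conformal x₀).lam (extChartAt (𝓡 2) x₀ x) ^ 3) := by
    intro u v hu hv
    rw [σ.del_eq hσ hx, eq_comm, Real.sqrt_eq_iff_mul_self_eq
      (div_nonneg (Complex.normSq_nonneg _) (pow_pos hl 3).le) (norm_nonneg _), ← sq, norm_mul,
      norm_mul, ← sq, norm_pow, mul_pow, mul_pow, J.norm_thetaForm_sq hx hu,
      J.norm_thetaForm_sq hx hv, Complex.normSq_eq_norm_sq]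
    field_simp
  obtain ⟨v, hv⟩ := J.exists_unit hx
  have : formNorm J x (σ.del x₀ x)
      = Real.sqrt (Complex.normSq ((J.conformal x₀).cov (σ.coeff x₀) 0 (extChartAt (𝓡 2) x₀ x))
        / (J.conformal x₀).lam (extChartAt (𝓡 2) x₀ x) ^ 3) := by
    apply csSup_const
    · rintro r ⟨u, v, hu, hv, rfl⟩
      exact key u v hu hv
    · exact ⟨v, v, hv, hv, (key v v hv hv).symm⟩
  rw [this, Real.sq_sqrt (div_nonneg (Complex.normSq_nonneg _) (pow_pos hl 3).le)]

lemma QuadraticDifferential.formNorm_dbar (hσ : σ.IsHolomorphic)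
    (hx : x ∈ (extChartAt (𝓡 2) x₀).source) : formNorm J x (σ.dbar x₀ x) = 0 := by
  obtain ⟨v, hv⟩ := J.exists_unit hx
  apply csSup_const
  · rintro r ⟨u, v, -, -, rfl⟩
    rw [hσ x₀ x hx, norm_zero]
  · exact ⟨v, v, hv, hv, by rw [hσ x₀ x hx, norm_zero]⟩

end Pointwise

/-! ### The moment map on the surface -/

section MomentMap

open PlaneConformal

variable {S : Type*} [TopologicalSpace S] [ChartedSpace Plane S] [IsManifold (𝓡 2) ∞ S]
  {ρ : AreaForm S} (J : ComplexStructure ρ) {x₀ x : S} {y : Plane} {f : S → ℝ}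

lemma diff_coordVec (hf : DifferentiableAt ℝ (fun z => f (chartInv x₀ z)) y)
    (hy : y ∈ (extChartAt (𝓡 2) x₀).target) (i : Fin 2) :
    diff f (chartInv x₀ y) (coordVec x₀ y i) = pd i (fun z => f (chartInv x₀ z)) y := by
  have hx := chartInv_mem hy
  have hf' : MDifferentiableAt (𝓡 2) 𝓘(ℝ, ℝ) f (chartInv x₀ y) := by
    have h1 : MDifferentiableAt (𝓡 2) 𝓘(ℝ, ℝ)
        ((fun z => f (chartInv x₀ z)) ∘ extChartAt (𝓡 2) x₀) (chartInv x₀ y) := by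
      refine MDifferentiableAt.comp (I' := 𝓡 2) _ ?_ (mdifferentiableAt_chart hx)
      rw [extChartAt_chartInv hy]
      exact hf.mdifferentiableAt
    refine h1.congr_of_eventuallyEq ?_
    filter_upwards [(isOpen_extChartAt_source (I := 𝓡 2) x₀).mem_nhds hx] with z hz
    exact congrArg f ((extChartAt (𝓡 2) x₀).left_inv hz).symm
  have h := mfderiv_comp y hf' (mdifferentiableAt_chartInv hy)
  rw [mfderiv_eq_fderiv] at h
  exact (congrArg (fun L => L (EuclideanSpace.single i (1 : ℝ) : Plane)) h).symm

/-- In a chart, `df ∘ J = V₁ dx - V₀ dy` for the flux `V` of `f`. -/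
lemma ComplexStructure.diff_map_coordVec
    (hf : DifferentiableAt ℝ (fun z => f (chartInv x₀ z)) y)
    (hy : y ∈ (extChartAt (𝓡 2) x₀).target) :
    diff f (chartInv x₀ y) (J.J _ (coordVec x₀ y 0))
      = (J.conformal x₀).flux (fun z => f (chartInv x₀ z)) 1 y ∧
    diff f (chartInv x₀ y) (J.J _ (coordVec x₀ y 1))
      = - (J.conformal x₀).flux (fun z => f (chartInv x₀ z)) 0 y := by
  obtain ⟨hc, hd, hb⟩ := J.coeff_relations hy
  rw [J.map_coordVec hy, J.map_coordVec hy, diff_add_smul, diff_add_smul, diff_coordVec hf hy,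
    diff_coordVec hf hy, hd, hb, flux_zero, flux_one]
  simp only [ComplexStructure.conformal]
  constructor
  · field_simp
  · field_simp
    ring

/-- `2i ∂̄∂f = Δf ρ`, with the Laplacian written as `-divFlux f / (λ m)`. -/
lemma ComplexStructure.dbarDel_eq
    (hf : ContDiffOn ℝ ∞ (fun z => f (chartInv x z)) (extChartAt (𝓡 2) x).target)
    (u v : Tan x) :
    2 * Complex.I * J.dbarDel f x u v
      = ((- (J.conformal x).divFlux (fun z => f (chartInv x z)) (extChartAt (𝓡 2) x x)
        / ((J.conformal x).lam (extChartAt (𝓡 2) x x)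
          * (J.conformal x).m (extChartAt (𝓡 2) x x)) * ρ.form x u v : ℝ) : ℂ) := by
  have hx : x ∈ (extChartAt (𝓡 2) x).source := mem_extChartAt_source x
  have hy := (extChartAt (𝓡 2) x).map_source hx
  set y := extChartAt (𝓡 2) x x with hy_def
  have hU := isOpen_target x
  have hl := (J.conformal x).lam_pos y hy
  have hm := (J.conformal x).m_ne y hy
  set F := fun z => f (chartInv x z) with hF
  have dF : ∀ z ∈ (extChartAt (𝓡 2) x).target, DifferentiableAt ℝ F z := fun z hz =>
    hf.differentiableAt_of_isOpen hU hz
  -- the components of `∂f = (df - i df ∘ J) / 2`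
  have e0 : Set.EqOn (fun z => J.del f (chartInv x z) (coordVec x z 0))
      (fun z => (1 / 2) * (((pd 0 F z : ℝ) : ℂ) - Complex.I * ((J.conformal x).flux F 1 z : ℂ)))
      (extChartAt (𝓡 2) x).target := by
    intro z hz
    simp only [ComplexStructure.del]
    rw [diff_coordVec (dF z hz) hz, (J.diff_map_coordVec (dF z hz) hz).1]
  have e1 : Set.EqOn (fun z => J.del f (chartInv x z) (coordVec x z 1))
      (fun z => (1 / 2) * (((pd 1 F z : ℝ) : ℂ) - Complex.I * -((J.conformal x).flux F 0 z : ℂ)))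
      (extChartAt (𝓡 2) x).target := by
    intro z hz
    simp only [ComplexStructure.del]
    rw [diff_coordVec (dF z hz) hz, (J.diff_map_coordVec (dF z hz) hz).2]
    push_cast
    rfl
  have dp : ∀ i, DifferentiableAt ℝ (pd i F) y := fun i =>
    (hf.pd hU i).differentiableAt_of_isOpen hU hy
  have dV : ∀ i, DifferentiableAt ℝ ((J.conformal x).flux F i) y := fun i =>
    (flux_smooth (C := J.conformal x) hf i).differentiableAt_of_isOpen hU hy
  have dpC : ∀ i, DifferentiableAt ℝ (fun z => ((pd i F z : ℝ) : ℂ)) y := fun i =>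
    Complex.ofRealCLM.differentiableAt.comp y (dp i)
  have dVC : ∀ i, DifferentiableAt ℝ (fun z => ((J.conformal x).flux F i z : ℂ)) y := fun i =>
    Complex.ofRealCLM.differentiableAt.comp y (dV i)
  have p1 : pd 1 (fun z => J.del f (chartInv x z) (coordVec x z 0)) y
      = (1 / 2) * (((pd 1 (pd 0 F) y : ℝ) : ℂ)
        - Complex.I * ((pd 1 ((J.conformal x).flux F 1) y : ℝ) : ℂ)) := by
    rw [pd_congr hU hy e0, pd_const_mul _ ((dpC 0).fun_sub ((dVC 1).const_mul _)),
      pd_sub (dpC 0) ((dVC 1).const_mul _), pd_const_mul _ (dVC 1), pd_ofReal (dp 0),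
      pd_ofReal (dV 1)]
  have p0 : pd 0 (fun z => J.del f (chartInv x z) (coordVec x z 1)) y
      = (1 / 2) * (((pd 0 (pd 1 F) y : ℝ) : ℂ)
        + Complex.I * ((pd 0 ((J.conformal x).flux F 0) y : ℝ) : ℂ)) := by
    have e : (fun z => (1 / 2) * (((pd 1 F z : ℝ) : ℂ)
        - Complex.I * -((J.conformal x).flux F 0 z : ℂ)))
        = fun z => (1 / 2) * (((pd 1 F z : ℝ) : ℂ) + Complex.I * ((J.conformal x).flux F 0 z : ℂ)) := by
      funext z
      ring
    rw [pd_congr hU hy e1, e, pd_const_mul _ ((dpC 1).fun_add ((dVC 0).const_mul _)),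
      pd_add (dpC 1) ((dVC 0).const_mul _), pd_const_mul _ (dVC 0), pd_ofReal (dp 1),
      pd_ofReal (dV 0)]
  have hI := Complex.I_mul_I
  rw [J.form_eq hx, ← hy_def, div_mul_eq_mul_div, mul_left_comm, mul_div_cancel_left₀ _
    (mul_ne_zero hl.ne' hm), divFlux]
  simp only [ComplexStructure.dbarDel, extD, Fin.sum_univ_two, ← hy_def, p0, p1, sub_self,
    mul_zero, zero_add, add_zero]
  rw [pd_comm hf hU hy 1 0]
  push_cast
  linear_combination ((comp x x u 0 * comp x x v 1 - comp x x u 1 * comp x x v 0)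
    * (((pd 0 ((J.conformal x).flux F 0) y : ℝ) : ℂ)
      + ((pd 1 ((J.conformal x).flux F 1) y : ℝ) : ℂ)) : ℂ) * hI

variable {J}

/-- The formula for the moment map at a pair `(J, σ)` with `σ` holomorphic and `|σ| < 1`, obtained
from `PlaneConformal.momentMap_eq` in the chart around the point. -/
lemma mu₁_eq [T2Space S] [SigmaCompactSpace S] (σ : QuadraticDifferential J)
    (h1 : ∀ x, σ.norm x < 1) (hσ : σ.IsHolomorphic) (x : S) (u v : Tan x) :
    mu₁ J σ x u v =
      ((-(2 * J.gaussCurvature x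
          + J.laplacian (fun z => Real.log (1 + Real.sqrt (1 - σ.norm z ^ 2))) x)
            * ρ.form x u v
        + 2 * ρ.c * ρ.form x u v : ℝ) : ℂ) := by
  have hx : x ∈ (extChartAt (𝓡 2) x).source := mem_extChartAt_source x
  have hy : extChartAt (𝓡 2) x x ∈ (J.conformal x).U := (extChartAt (𝓡 2) x).map_source hx
  have hQ := σ.coeff_smooth x
  have hs := normSq_smooth hQ
  have hn : ∀ z ∈ (J.conformal x).U, σ.norm (chartInv x z) ^ 2
      = (J.conformal x).normSq (σ.coeff x) z := fun z hz => by
    rw [σ.norm_sq (chartInv_mem hz), extChartAt_chartInv hz]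
  have hlt : ∀ z ∈ (J.conformal x).U, (J.conformal x).normSq (σ.coeff x) z < 1 := by
    intro z hz
    rw [← hn z hz]
    have h0 : 0 ≤ σ.norm (chartInv x z) := by
      apply Real.sSup_nonneg
      rintro r ⟨v, -, rfl⟩
      exact norm_nonneg _
    exact pow_lt_one₀ h0 (h1 _) two_ne_zero
  have smw : ContDiffOn ℝ ∞ (fun z => Real.sqrt (1 - (J.conformal x).normSq (σ.coeff x) z))
      (J.conformal x).U :=
    (contDiffOn_const.sub hs).sqrt fun z hz => (sub_pos.2 (hlt z hz)).ne'
  have sml : ContDiffOn ℝ ∞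
      (fun z => Real.log (1 + Real.sqrt (1 - (J.conformal x).normSq (σ.coeff x) z)))
      (J.conformal x).U :=
    (contDiffOn_const.add smw).log fun z _ =>
      (add_pos_of_pos_of_nonneg one_pos (Real.sqrt_nonneg _)).ne'
  have ew : Set.EqOn (fun z => Real.sqrt (1 - σ.norm (chartInv x z) ^ 2))
      (fun z => Real.sqrt (1 - (J.conformal x).normSq (σ.coeff x) z)) (J.conformal x).U :=
    fun z hz => by simp only [hn z hz]
  have el : Set.EqOn (fun z => Real.log (1 + Real.sqrt (1 - σ.norm (chartInv x z) ^ 2)))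
      (fun z => Real.log (1 + Real.sqrt (1 - (J.conformal x).normSq (σ.coeff x) z)))
      (J.conformal x).U :=
    fun z hz => by simp only [hn z hz]
  have hK : J.gaussCurvature x = _ := gauss_eq (J.gram_eq x) hy
  have hL : J.laplacian (fun z => Real.log (1 + Real.sqrt (1 - σ.norm z ^ 2))) x = _ :=
    laplacian_eq (J.gram_eq x) (sml.congr el) hy
  have hD := J.dbarDel_eq (f := fun z => Real.sqrt (1 - σ.norm z ^ 2)) (smw.congr ew) u v
  rw [divFlux_congr el hy] at hL
  rw [divFlux_congr ew hy] at hD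
  have key := momentMap_eq hQ (fun z hz => σ.cov_one hσ hz) hlt hy
  rw [mu₁, hD, σ.formNorm_del_sq hσ hx, σ.formNorm_dbar hσ hx, σ.norm_sq hx, hL, hK]
  norm_cast
  linear_combination ρ.form x u v * key

end MomentMap

end AlmostFuchsian

end

open AlmostFuchsian in
theorem mainTheorem10 {S : Type*} [TopologicalSpace S] [ChartedSpace Plane S]
    [IsManifold (𝓡 2) ∞ S] [T2Space S] [CompactSpace S] [ConnectedSpace S] (ρ : AreaForm S) :
    (∀ (J : ComplexStructure ρ) (σ : QuadraticDifferential J), (∀ x, σ.norm x < 1) →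
      σ.IsHolomorphic → ∀ (x : S) (u v : Tan x),
        mu₁ J σ x u v =
          ((-(2 * J.gaussCurvature x
              + J.laplacian (fun z => Real.log (1 + Real.sqrt (1 - σ.norm z ^ 2))) x)
                * ρ.form x u v
            + 2 * ρ.c * ρ.form x u v : ℝ) : ℂ)) ∧
    moduliSpace ρ =
      QPair.mk₀ '' {p : QPair ρ | p.σ.IsHolomorphic ∧ (∀ x, p.σ.norm x < 1) ∧
        ∀ x, p.J.gaussCurvature x
          + (1 / 2) * p.J.laplacian (fun z => Real.log (1 + Real.sqrt (1 - p.σ.norm z ^ 2))) x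
            = ρ.c} := by
  refine ⟨fun J σ h1 hσ x u v => mu₁_eq σ h1 hσ x u v, ?_⟩
  unfold moduliSpace
  congr 1
  ext ⟨J, σ⟩
  constructor
  · rintro ⟨hμ, hσ, h1⟩
    refine ⟨hσ, h1, fun x => ?_⟩
    -- the area form does not vanish at `x`
    obtain ⟨u, hu⟩ := DFunLike.ne_iff.1 (ρ.ne_zero x)
    obtain ⟨v, hv⟩ := DFunLike.ne_iff.1 hu
    have h := hμ x u v
    rw [mu₁_eq σ h1 hσ, Complex.ofReal_eq_zero, ← add_mul] at h
    have h' := (mul_eq_zero.1 h).resolve_right hv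
    linarith
  · rintro ⟨hσ, h1, hK⟩
    refine ⟨fun x u v => ?_, hσ, h1⟩
    have h := hK x
    simp only at h
    rw [mu₁_eq σ h1 hσ, Complex.ofReal_eq_zero]
    linear_combination (-2 * ρ.form x u v) * h
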